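/- **Setting.** Let $(X^p)_{p\in I}$ be finitely many real-valued time series $X^p=(X^p_s)_{s\in\mathbb Z}$ on a probability space, let $t\in\mathbb Z$ and $\gamma\in\mathbb N$. Let $V$ consist, for each $p\in I$, of a past vertex $X^p_{t-}$, standing for the window $(X^p_{t-\gamma},\dots,X^p_{t-1})$, and a present vertex $X^p_t$. An *extended summary causal graph* (ESCG) is a DAG on $V$ all of whose edges point to present vertices. The distribution of $V$ is *faithful* to a DAG $\mathcal G$ if, for distinct $u,v\in V$ and $R\subseteq V\setminus\{u,v\}$, $u$ and $v$ are conditionally independent given $R$ if and only if $R$ d-separates $u$ and $v$ in $\mathcal G$. Write $I$ for (conditional) mutual information and $\mathrm{GCE}(X^p\to X^q\mid R)=I(X^q_t;X^p_{t-\gamma:t-1}\mid R)$ for the greedy causation entropy, $R$ being a set of past windows and present instants. **Procedure PCGCE (with the exact values of $I$ and $\mathrm{GCE}$, i.e. perfect conditional independence information).** *Skeleton.* Start from the graph in which every past vertex is joined to every present vertex and the present vertices are pairwise joined. For $n=0,1,2,\dots$, and for every edge $u-v$ present at the start of level $n$ and every set $R$ of $n$ vertices which, in the graph at the start of the level, are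 all neighbours of $u$ other than $v$, or all neighbours of $v$ other than $u$: if the edge is still present, test whether $\mathrm{GCE}(\cdot\to\cdot\mid R)=0$ (for an edge between past and present) or $I(\cdot;\cdot\mid R)=0$ (for an edge between present vertices); if so, remove the edge and record $\mathrm{Sepset}(u,v)=R$. The tests of a level may be done in any order. *Orientation.* Below, a triple $a,r,b$ is *unshielded* if $a,r$ and $r,b$ are adjacent in the skeleton obtained and the distinct vertices $a,b$ are not. 1. (Temporal priority) Orient every edge between past and present from past to present. 2. (Origin of causality) For every unshielded triple $a,r,X^p_t$ with $r$ a present vertex and $a$ a past or present vertex, if $r\notin\mathrm{Sepset}(a,X^p_t)$, orient $a\to r\leftarrow X^p_t$. 3. After all these orientations, apply the following rules, in any order, until none applies. - (Propagation of causality) If $a\to r - X^q_t$ is an unshielded triple with $a$ a past or present vertex, $r$ a present vertex, and $r\in\mathrm{Sepset}(a,X^q_t)$, orient $r\to X^q_t$. - If $X^p_t-X^q_t$ and there is a directed path from $X^p_t$ to $X^q_t$, orient $X^p_t\to X^q_t$. - If $X^p_t-X^q_t$, $X^p_t-X^r_t\to X^q_t$ and $X^p_t-X^s_t\to X^q_t$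 with $r\ne s$ and $X^r_t,X^s_t$ not adjacent, orient $X^p_t\to X^q_t$. **Theorem.** Assume that the distribution of $V$ is faithful to an extended summary causal graph $\mathcal G$. Then PCGCE has an output, and each of its outputs (whatever the order of the tests and of the rule applications) is the CPDAG of $\mathcal G$, representing the Markov equivalence class of $\mathcal G$ among extended summary causal graphs: writing $[\mathcal G]$ for the set of all ESCGs on $V$ with the same d-separations as $\mathcal G$, the output contains the directed edge $u\to v$ if and only if every graph in $[\mathcal G]$ contains $u\to v$, and the undirected edge $u-v$ if and only if some graph in $[\mathcal G]$ contains $u\to v$ and some graph in $[\mathcal G]$ contains $v\to u$. -/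

import Mathlib

open MeasureTheory ProbabilityTheory InformationTheory
open scoped ENNReal

namespace PCGCE

/-! ### Directed acyclic graphs, d-separation, Markov equivalence -/

/-- A directed acyclic graph on the vertex set `V`. -/
structure DAG (V : Type*) where
  edge : V → V → Prop
  acyclic : ∀ v, ¬ Relation.TransGen edge v v

/-- The skeleton of a DAG. -/
def DAG.skeleton {V : Type*} (G : DAG V) : SimpleGraph V where
  Adj u v := G.edge u v ∨ G.edge v u
  symm := ⟨fun _ _ h => h.symm⟩
  loopless := ⟨fun v h => G.acyclic v (Relation.TransGen.single (h.elim id id))⟩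

/-- The consecutive vertices `a, b, c` of a path do not block it given `C`: if `b` is a collider
then `b` or one of its descendants is in `C`, otherwise `b` is not in `C`. -/
def DAG.OpenAt {V : Type*} (G : DAG V) (C : Set V) (a b c : V) : Prop :=
  (G.edge a b ∧ G.edge c b → ∃ z ∈ C, Relation.ReflTransGen G.edge b z) ∧
  (¬ (G.edge a b ∧ G.edge c b) → b ∉ C)

/-- `u` and `v` are d-separated by `C`: every path between them is blocked by `C`. -/
def DAG.DSep {V : Type*} (G : DAG V) (u v : V) (C : Set V) : Prop :=
  ∀ w : G.skeleton.Walk u v, w.IsPath →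
    ¬ ∀ i, i + 2 ≤ w.length → G.OpenAt C (w.getVert i) (w.getVert (i + 1)) (w.getVert (i + 2))

/-- Markov equivalence: the two DAGs have the same d-separations. -/
def DAG.MarkovEquiv {V : Type*} (G H : DAG V) : Prop :=
  ∀ (u v : V) (C : Set V), u ≠ v → u ∉ C → v ∉ C → (G.DSep u v C ↔ H.DSep u v C)

/-- A partially directed graph: directed edges and (symmetric) undirected edges. -/
@[ext]
structure PDAG (V : Type*) where
  directed : V → V → Prop
  undirected : V → V → Prop

/-! ### Extended summary causal graphs -/

/-- The vertices of an extended summary graph over the time series `ι`: for every series `p`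
a vertex `past p` (standing for the window `t - γ : t - 1`) and a vertex `present p`. -/
abbrev Node (ι : Type*) := ι ⊕ ι

abbrev past {ι : Type*} (p : ι) : Node ι := Sum.inl p

abbrev present {ι : Type*} (p : ι) : Node ι := Sum.inr p

/-- Extended summary causal graphs: DAGs in which only vertices of the present slice are effects,
that is, all edges go from past to present or from present to present. -/
def IsExtendedSummary {ι : Type*} (G : DAG (Node ι)) : Prop :=
  ∀ (u : Node ι) (p : ι), ¬ G.edge u (past p)

/-- The CPDAG representing the Markov equivalence class of `G` among extended summary causal
graphs. An edge is directed if all members of the class contain it with that direction, and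
undirected if both of its directions occur in the class. -/
def cpdag {ι : Type*} (G : DAG (Node ι)) : PDAG (Node ι) where
  directed u v := ∀ H : DAG (Node ι), IsExtendedSummary H → G.MarkovEquiv H → H.edge u v
  undirected u v :=
    (∃ H : DAG (Node ι), IsExtendedSummary H ∧ G.MarkovEquiv H ∧ H.edge u v) ∧
    (∃ H : DAG (Node ι), IsExtendedSummary H ∧ G.MarkovEquiv H ∧ H.edge v u)

/-! ### Random variables attached to the vertices, mutual information, causation entropy -/

/-- The lags attached to a vertex: `1, …, γ` for a past vertex, only `0` for a present vertex. -/
def lags {ι : Type*} (γ : ℕ) : Node ι → Finset ℕ :=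
  Sum.elim (fun _ => Finset.Icc 1 γ) (fun _ => {0})

/-- The values of the variable attached to a vertex. -/
abbrev Val {ι : Type*} (γ : ℕ) (v : Node ι) := lags γ v → ℝ

/-- The random variable attached to a vertex: `X^p_{t-γ:t-1}` for `past p`, `X^p_t` for
`present p`. -/
def nodeVar {ι Ω : Type*} (X : ι → ℤ → Ω → ℝ) (t : ℤ) (γ : ℕ) (v : Node ι) (ω : Ω) : Val γ v :=
  fun ℓ => X (Sum.elim id id v) (t - ((ℓ : ℕ) : ℤ)) ω

/-- The joint random variable attached to a set of vertices. -/
def nodeVars {ι Ω : Type*} (X : ι → ℤ → Ω → ℝ) (t : ℤ) (γ : ℕ) (R : Finset (Node ι)) (ω : Ω) :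
    ∀ v : R, Val γ (v : Node ι) :=
  fun v => nodeVar X t γ v ω

/-- Conditional mutual information `I(f; g | h)`: the Kullback-Leibler divergence of the joint
law of `(h, f, g)` from the law under which `f` and `g` keep their conditional laws given `h` but
are conditionally independent. -/
noncomputable def condMutualInfo {Ω α β κ : Type*} [MeasurableSpace Ω]
    [MeasurableSpace α] [StandardBorelSpace α] [Nonempty α]
    [MeasurableSpace β] [StandardBorelSpace β] [Nonempty β] [MeasurableSpace κ]
    (f : Ω → α) (g : Ω → β) (h : Ω → κ) (μ : Measure Ω) [IsFiniteMeasure μ] : ℝ≥0∞ :=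
  klDiv (μ.map fun ω => (h ω, f ω, g ω))
    ((μ.map h).compProd ((condDistrib f h μ).prod (condDistrib g h μ)))

/-- Conditional mutual information `I(X^p_t; X^q_t | X^R)` between present vertices. -/
noncomputable def presentMI {ι Ω : Type*} [MeasurableSpace Ω] (X : ι → ℤ → Ω → ℝ) (t : ℤ) (γ : ℕ)
    (μ : Measure Ω) [IsFiniteMeasure μ] (p q : ι) (R : Finset (Node ι)) : ℝ≥0∞ :=
  condMutualInfo (nodeVar X t γ (present p)) (nodeVar X t γ (present q)) (nodeVars X t γ R) μ

/-- The (conditional) greedy causation entropy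
`GCE(X^p → X^q | X^R) = I(X^q_t; X^p_{t-γ:t-1} | X^R)`; the conditioning variables are present
instants or past windows, and `R = ∅` gives the unconditional quantity. -/
noncomputable def gce {ι Ω : Type*} [MeasurableSpace Ω] (X : ι → ℤ → Ω → ℝ) (t : ℤ) (γ : ℕ)
    (μ : Measure Ω) [IsFiniteMeasure μ] (p q : ι) (R : Finset (Node ι)) : ℝ≥0∞ :=
  condMutualInfo (nodeVar X t γ (present q)) (nodeVar X t γ (past p)) (nodeVars X t γ R) μ

/-! ### Faithfulness -/

theorem measurable_restrict {ι : Type*} (γ : ℕ) (R : Finset (Node ι)) :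
    Measurable fun (x : ∀ v : Node ι, Val γ v) (v : R) => x (v : Node ι) :=
  measurable_pi_lambda _ fun v => measurable_pi_apply (v : Node ι)

/-- The joint distribution of the variables attached to all the vertices. -/
noncomputable def jointLaw {ι Ω : Type*} [MeasurableSpace Ω] (X : ι → ℤ → Ω → ℝ) (t : ℤ) (γ : ℕ)
    (μ : Measure Ω) : Measure (∀ v : Node ι, Val γ v) :=
  μ.map fun ω v => nodeVar X t γ v ω

/-- A distribution `P` of the variables is faithful to the DAG `G` (Markov property included):
two distinct variables are conditionally independent given a set of other variables exactly if
the set d-separates them. By the semi-graphoid properties of conditional independence and of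
d-separation this is the same as asking it for all triples of disjoint sets of variables. -/
def Faithful {ι : Type*} [Fintype ι] {γ : ℕ} (P : Measure (∀ v : Node ι, Val γ v))
    [IsFiniteMeasure P] (G : DAG (Node ι)) : Prop :=
  ∀ (u v : Node ι) (R : Finset (Node ι)), u ≠ v → u ∉ R → v ∉ R →
    (CondIndepFun (MeasurableSpace.comap
        (fun (x : ∀ v : Node ι, Val γ v) (w : R) => x (w : Node ι)) inferInstance)
        (measurable_restrict γ R).comap_le (fun x => x u) (fun x => x v) P ↔
      G.DSep u v (R : Set (Node ι)))

instance jointLaw_finite {ι Ω : Type*} [MeasurableSpace Ω] (X : ι → ℤ → Ω → ℝ) (t : ℤ) (γ : ℕ)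
    (μ : Measure Ω) [IsFiniteMeasure μ] : IsFiniteMeasure (jointLaw X t γ μ) := by
  unfold jointLaw; infer_instance

/-! ### Skeleton construction -/

/-- The initial graph: every past vertex is joined to every present vertex, and the present
vertices are joined to one another. -/
def initialGraph (ι : Type*) : SimpleGraph (Node ι) where
  Adj u v := u ≠ v ∧ ¬ (u.isLeft ∧ v.isLeft)
  symm := ⟨fun _ _ h => ⟨h.1.symm, fun h' => h.2 h'.symm⟩⟩
  loopless := ⟨fun _ h => h.1 rfl⟩

/-- The independence tests: the greedy causation entropy is used between the past slice and the
present slice, mutual information is used inside the present slice. -/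
inductive TestedIndep {ι Ω : Type*} [MeasurableSpace Ω] (X : ι → ℤ → Ω → ℝ) (t : ℤ) (γ : ℕ)
    (μ : Measure Ω) [IsFiniteMeasure μ] : Node ι → Node ι → Finset (Node ι) → Prop
  | past_present (p q : ι) (R : Finset (Node ι)) (h : gce X t γ μ p q R = 0) :
      TestedIndep X t γ μ (past p) (present q) R
  | present_past (p q : ι) (R : Finset (Node ι)) (h : gce X t γ μ p q R = 0) :
      TestedIndep X t γ μ (present q) (past p) R
  | present_present (p q : ι) (R : Finset (Node ι)) (h : presentMI X t γ μ p q R = 0) :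
      TestedIndep X t γ μ (present p) (present q) R

/-- A state of the skeleton construction: the current graph and the separation sets that have
been recorded for removed edges. -/
structure SkelState (ι : Type*) where
  graph : SimpleGraph (Node ι)
  sepset : Sym2 (Node ι) → Finset (Node ι)

/-- The tests of level `n` on the graph `S`: an edge `u - v` with a set of `n` vertices, all
different from `u` and `v`, that are all connected to `u` or all connected to `v`. -/
def IsTest {ι : Type*} (S : SimpleGraph (Node ι)) (n : ℕ)
    (T : Node ι × Node ι × Finset (Node ι)) : Prop :=
  S.Adj T.1 T.2.1 ∧ T.2.2.card = n ∧
    ((∀ w ∈ T.2.2, S.Adj T.1 w ∧ w ≠ T.2.1) ∨ (∀ w ∈ T.2.2, S.Adj T.2.1 w ∧ w ≠ T.1))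

open Classical in
/-- Performing one test: if the edge is still present and independence is found, the edge is
removed and the conditioning set is recorded. The other tests of an edge have no effect once it
has been removed. -/
noncomputable def performTest {ι Ω : Type*} [MeasurableSpace Ω] (X : ι → ℤ → Ω → ℝ) (t : ℤ)
    (γ : ℕ) (μ : Measure Ω) [IsFiniteMeasure μ] (s : SkelState ι)
    (T : Node ι × Node ι × Finset (Node ι)) : SkelState ι :=
  if s.graph.Adj T.1 T.2.1 ∧ TestedIndep X t γ μ T.1 T.2.1 T.2.2 then
    { graph := s.graph.deleteEdges {s(T.1, T.2.1)}
      sepset := Function.update s.sepset s(T.1, T.2.1) T.2.2 }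
  else s

/-- `SkelRun X t γ μ n s`: the state `s` can be reached after the levels `0, …, n - 1`. The tests
of a level are determined by the graph at the beginning of the level and may be performed in any
order, in particular in the order of their scores, ties being broken arbitrarily. -/
inductive SkelRun {ι Ω : Type*} [MeasurableSpace Ω] (X : ι → ℤ → Ω → ℝ) (t : ℤ) (γ : ℕ)
    (μ : Measure Ω) [IsFiniteMeasure μ] : ℕ → SkelState ι → Prop
  | init : SkelRun X t γ μ 0 ⟨initialGraph ι, fun _ => ∅⟩
  | level (n : ℕ) (s : SkelState ι) (L : List (Node ι × Node ι × Finset (Node ι)))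
      (hs : SkelRun X t γ μ n s) (hL : ∀ T, T ∈ L ↔ IsTest s.graph n T) :
      SkelRun X t γ μ (n + 1) (L.foldl (performTest X t γ μ) s)

/-! ### Orientation -/

/-- The arrows given by temporal priority and by the origin of causality (unshielded colliders)
on the skeleton. -/
inductive InitArrow {ι : Type*} (s : SkelState ι) : Node ι → Node ι → Prop
  | temporal (p q : ι) (h : s.graph.Adj (past p) (present q)) :
      InitArrow s (past p) (present q)
  | collider_present (p r q : ι) (hpq : p ≠ q) (hp : s.graph.Adj (present p) (present r))
      (hq : s.graph.Adj (present q) (present r)) (h : ¬ s.graph.Adj (present p) (present q))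
      (hr : present r ∉ s.sepset s(present p, present q)) :
      InitArrow s (present p) (present r)
  | collider_past (p r q : ι) (hp : s.graph.Adj (present p) (present r))
      (hq : s.graph.Adj (past q) (present r)) (h : ¬ s.graph.Adj (past q) (present p))
      (hr : present r ∉ s.sepset s(past q, present p)) :
      InitArrow s (present p) (present r)

/-- The edge `u - v` is in the skeleton and is not oriented by the arrows `D`. -/
def Unoriented {ι : Type*} (s : SkelState ι) (D : Node ι → Node ι → Prop) (u v : Node ι) : Prop :=
  s.graph.Adj u v ∧ ¬ D u v ∧ ¬ D v u

/-- `OrientRule s D u v`: one of the three remaining rules, applied to the arrows `D`, orients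
the edge `u - v` as `u → v`. -/
inductive OrientRule {ι : Type*} (s : SkelState ι) (D : Node ι → Node ι → Prop) :
    Node ι → Node ι → Prop
  | propagation (u : Node ι) (r q : ι) (hur : D u (present r))
      (hrq : Unoriented s D (present r) (present q)) (hne : u ≠ present q)
      (h : ¬ s.graph.Adj u (present q)) (hr : present r ∈ s.sepset s(u, present q)) :
      OrientRule s D (present r) (present q)
  | directed_path (p q : ι) (h : Relation.TransGen D (present p) (present q))
      (hpq : Unoriented s D (present p) (present q)) :
      OrientRule s D (present p) (present q)
  | two_paths (p q r r' : ι) (hpq : Unoriented s D (present p) (present q))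
      (hpr : Unoriented s D (present p) (present r)) (hrq : D (present r) (present q))
      (hpr' : Unoriented s D (present p) (present r')) (hrq' : D (present r') (present q))
      (hne : r ≠ r') (h : ¬ s.graph.Adj (present r) (present r')) :
      OrientRule s D (present p) (present q)

/-- One application of a rule: a single arrow is added. -/
def OrientStep {ι : Type*} (s : SkelState ι) (D D' : Node ι → Node ι → Prop) : Prop :=
  ∃ u v, OrientRule s D u v ∧ D' = fun a b => D a b ∨ (a = u ∧ b = v)

/-- `P` is an output of PCGCE, run with the exact values of the information measures: the
skeleton construction goes through all sizes of conditioning sets, then the initial arrows are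
drawn, then the remaining rules are applied, in any order, until none applies. -/
def IsOutput {ι Ω : Type*} [Fintype ι] [MeasurableSpace Ω] (X : ι → ℤ → Ω → ℝ) (t : ℤ) (γ : ℕ)
    (μ : Measure Ω) [IsFiniteMeasure μ] (P : PDAG (Node ι)) : Prop :=
  ∃ (s : SkelState ι) (D : Node ι → Node ι → Prop),
    SkelRun X t γ μ (Fintype.card (Node ι)) s ∧
    Relation.ReflTransGen (OrientStep s) (InitArrow s) D ∧
    (∀ u v, ¬ OrientRule s D u v) ∧
    P = ⟨D, Unoriented s D⟩

end PCGCE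

/-! A conditional mutual information is a Kullback-Leibler divergence, so it vanishes exactly under
conditional independence; by faithfulness each test then decides d-separation in `G`, and the rest
is graph theory.

Skeleton. Adjacent vertices are never d-separated, so no edge of `G` is lost. Of two nonadjacent
vertices, one is not an ancestor of the other, and is separated from it by its own parents. These
always remain neighbours, so this set is tested at the level of its size (`SkelRun.graph_eq`).

Equivalence. Two DAGs have the same d-separations iff they share skeleton and unshielded colliders
(`SamePattern.markovEquiv`, `MarkovEquiv.samePattern`). The hard direction transfers a shortest open
walk: its colliders agree in both graphs, and each can be replaced by one with a descendant in `C`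
in both.

Orientation. Recorded separating sets reveal the unshielded colliders, and each rule only draws
arrows shared by the whole class (`IsSkeletonOf.arrow_edge`). For completeness, Meek's argument
shows that at closure `a → b - c` forces `a → c`
(`IsClosedUnderRules.arrow_of_arrow_of_unoriented`). Hence the unoriented part can be oriented on
its own: it has a perfect ordering, which may start at any vertex `v`, and orienting along it gives
a member of the class where all unoriented edges at `v` leave `v` (`IsSkeletonOf.exists_root`). Both
directions of each unoriented edge therefore occur. -/

namespace PCGCE

/-! ### d-connecting walks -/

namespace DAG

variable {V : Type*} {G H : DAG V} {C : Set V}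

theorem not_edge_of_reflTransGen {a b : V} (h : Relation.ReflTransGen G.edge a b) :
    ¬ G.edge b a := fun h' => G.acyclic b (Relation.TransGen.head' h' h)

theorem not_edge_symm {a b : V} (h : G.edge a b) : ¬ G.edge b a :=
  not_edge_of_reflTransGen (Relation.ReflTransGen.single h)

theorem ne_of_edge {a b : V} (h : G.edge a b) : a ≠ b := by
  rintro rfl
  exact G.acyclic a (Relation.TransGen.single h)

theorem openAt_swap {a b c : V} (h : G.OpenAt C a b c) : G.OpenAt C c b a :=
  ⟨fun h' => h.1 h'.symm, fun h' => h.2 fun h'' => h' h''.symm⟩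

/-- The vertices `x 0, …, x n` form a walk that is open given `C`. -/
structure IsOpenWalk (G : DAG V) (C : Set V) (n : ℕ) (x : ℕ → V) : Prop where
  adj : ∀ i, i < n → G.skeleton.Adj (x i) (x (i + 1))
  openAt : ∀ i, i + 2 ≤ n → G.OpenAt C (x i) (x (i + 1)) (x (i + 2))

/-- An open walk of minimal length between its endpoints. -/
structure IsShortest (G : DAG V) (C : Set V) (n : ℕ) (x : ℕ → V) : Prop
    extends IsOpenWalk G C n x where
  le : ∀ m y, IsOpenWalk G C m y → y 0 = x 0 → y m = x n → n ≤ m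

theorem IsOpenWalk.reverse {n : ℕ} {x : ℕ → V} (h : IsOpenWalk G C n x) :
    IsOpenWalk G C n fun i => x (n - i) := by
  constructor
  · intro i hi
    obtain ⟨k, rfl⟩ : ∃ k, n = k + 1 + i := ⟨n - i - 1, by omega⟩
    have := (h.adj k (by omega)).symm
    simpa [show k + 1 + i - i = k + 1 by omega, show k + 1 + i - (i + 1) = k by omega] using this
  · intro i hi
    obtain ⟨k, rfl⟩ : ∃ k, n = k + 2 + i := ⟨n - i - 2, by omega⟩
    have := openAt_swap (h.openAt k (by omega))
    simpa [show k + 2 + i - i = k + 2 by omega, show k + 2 + i - (i + 1) = k + 1 by omega,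
      show k + 2 + i - (i + 2) = k by omega] using this

theorem IsShortest.reverse {n : ℕ} {x : ℕ → V} (h : IsShortest G C n x) :
    IsShortest G C n fun i => x (n - i) := by
  refine ⟨h.toIsOpenWalk.reverse, fun m y hy h0 hm => ?_⟩
  exact h.le m _ hy.reverse (by simpa using hm) (by simpa using h0)

theorem exists_isShortest {n : ℕ} {x : ℕ → V} (h : IsOpenWalk G C n x) :
    ∃ m y, IsShortest G C m y ∧ y 0 = x 0 ∧ y m = x n := by
  classical
  have hex : ∃ m y, IsOpenWalk G C m y ∧ y 0 = x 0 ∧ y m = x n := ⟨n, x, h, rfl, rfl⟩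
  obtain ⟨y, hy, h0, hm⟩ := Nat.find_spec hex
  refine ⟨Nat.find hex, y, ⟨hy, fun m z hz hz0 hzm => ?_⟩, h0, hm⟩
  exact Nat.find_min' hex ⟨z, hz, hz0.trans h0, hzm.trans hm⟩

/-- A shortcut past `k` inner vertices changes only the triples centred at its two ends, so openness
is required only there. -/
theorem IsOpenWalk.splice {n i k : ℕ} {x : ℕ → V} (h : IsOpenWalk G C n x) (hik : i + 1 + k ≤ n)
    (hadj : G.skeleton.Adj (x i) (x (i + 1 + k)))
    (hl : ∀ j, j + 1 = i → G.OpenAt C (x j) (x i) (x (i + 1 + k)))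
    (hr : i + 2 + k ≤ n → G.OpenAt C (x i) (x (i + 1 + k)) (x (i + 2 + k))) :
    ∃ y, IsOpenWalk G C (n - k) y ∧ y 0 = x 0 ∧ y (n - k) = x n := by
  refine ⟨fun m => if m ≤ i then x m else x (m + k), ⟨fun m hm => ?_, fun m hm => ?_⟩, by simp, ?_⟩
  · rcases lt_trichotomy m i with hmi | rfl | hmi
    · simpa [hmi.le, Nat.succ_le_of_lt hmi] using h.adj m (by omega)
    · simpa using hadj
    · simpa [hmi.not_ge, show ¬ m + 1 ≤ i by omega, add_right_comm] using h.adj (m + k) (by omega)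
  · rcases Nat.lt_or_ge i m with hmi | hmi
    · simpa [hmi.not_ge, show ¬ m + 1 ≤ i by omega, show ¬ m + 2 ≤ i by omega, add_right_comm]
        using h.openAt (m + k) (by omega)
    · rcases hmi.eq_or_lt with rfl | hmi
      · simpa using hr (by omega)
      · rcases (Nat.succ_le_of_lt hmi).eq_or_lt with rfl | hmi'
        · simpa [add_right_comm _ k] using hl m rfl
        · simpa [hmi.le, Nat.succ_le_of_lt hmi, show m + 2 ≤ i by omega]
            using h.openAt m (by omega)
  · simp [show ¬ n - k ≤ i by omega, show n - k + k = n by omega]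

theorem IsOpenWalk.drop {n j : ℕ} {x : ℕ → V} (h : IsOpenWalk G C n x) (hj : j ≤ n) :
    IsOpenWalk G C (n - j) fun i => x (i + j) := by
  constructor
  · intro i hi
    simpa [add_right_comm] using h.adj (i + j) (by omega)
  · intro i hi
    simpa [add_right_comm] using h.openAt (i + j) (by omega)

/-- A walk leaving `x i` by an outgoing edge stays directed up to its first collider; if that
collider is open, its descendant in `C` is also one of `x i`. -/
theorem IsOpenWalk.directed_or_reach {n i : ℕ} {x : ℕ → V} (h : IsOpenWalk G C n x)
    (he : G.edge (x i) (x (i + 1))) (k : ℕ) (hk : i + 1 + k ≤ n) :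
    (G.edge (x (i + k)) (x (i + 1 + k)) ∧ Relation.TransGen G.edge (x i) (x (i + 1 + k))) ∨
      ∃ z ∈ C, Relation.ReflTransGen G.edge (x i) z := by
  induction k with
  | zero => exact Or.inl ⟨he, .single he⟩
  | succ k ih =>
    rcases ih (by omega) with ⟨h1, h2⟩ | h1
    · have e1 : i + k + 1 = i + 1 + k := by omega
      have e2 : i + k + 2 = i + 1 + (k + 1) := by omega
      have ho := h.openAt (i + k) (by omega)
      have ha := h.adj (i + 1 + k) (by omega)
      rw [e1, e2] at ho
      rcases ha with ha | ha
      · exact Or.inl ⟨by rwa [show i + (k + 1) = i + 1 + k by omega], h2.tail ha⟩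
      · obtain ⟨z, hz, hz'⟩ := ho.1 ⟨h1, ha⟩
        exact Or.inr ⟨z, hz, h2.to_reflTransGen.trans hz'⟩
    · exact Or.inr h1

theorem IsShortest.ne {n i j : ℕ} {x : ℕ → V} (h : IsShortest G C n x) (hij : i < j) (hj : j ≤ n) :
    x i ≠ x j := by
  intro heq
  obtain _ | i := i
  · have := h.le _ _ (h.drop hj) (by simpa using heq.symm) (by simp [hj])
    omega
  · obtain ⟨k, rfl⟩ : ∃ k, j = i + 1 + (k + 1) := ⟨j - i - 2, by omega⟩
    -- The loop at the repeated vertex is cut out. If this creates a collider there, either it was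
    -- one on first visit, or the loop leaves it by an outgoing edge; not being a directed cycle,
    -- the loop then yields a descendant in `C`.
    have hsp := h.splice (i := i) (k := k + 1) hj (heq ▸ h.adj i (by omega))
      (fun l hl => by
        subst hl
        have := h.openAt l (by omega)
        rwa [heq] at this)
      (fun hn => by
        have h1 := h.openAt i (by omega)
        have h2 := h.openAt (i + 1 + k) (by omega)
        have e1 : i + 1 + k + 1 = i + 1 + (k + 1) := by omega
        have e2 : i + 1 + k + 2 = i + 2 + (k + 1) := by omega
        rw [e1, e2] at h2
        rw [← heq] at h2 ⊢
        constructor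
        · rintro ⟨h3, h4⟩
          rcases h.adj (i + 1) (by omega) with h5 | h5
          · rcases h.directed_or_reach h5 k (by omega) with ⟨_, h6⟩ | h6
            · rw [show i + 1 + 1 + k = i + 1 + (k + 1) by omega, ← heq] at h6
              exact (G.acyclic _ h6).elim
            · exact h6
          · exact h1.1 ⟨h3, h5⟩
        · intro h3
          by_cases h4 : G.edge (x i) (x (i + 1))
          · exact h2.2 fun h5 => h3 ⟨h4, h5.2⟩
          · exact h1.2 fun h5 => h4 h5.1)
    obtain ⟨y, hy, h0, hm⟩ := hsp
    have := h.le _ _ hy h0 hm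
    omega

theorem exists_walk_of_adj {S : SimpleGraph V} (n : ℕ) (x : ℕ → V)
    (h : ∀ i, i < n → S.Adj (x i) (x (i + 1))) :
    ∃ w : S.Walk (x 0) (x n), w.length = n ∧ ∀ i, i ≤ n → w.getVert i = x i := by
  induction n generalizing x with
  | zero => exact ⟨.nil, rfl, fun i hi => by simp [Nat.le_zero.1 hi]⟩
  | succ n ih =>
    obtain ⟨w, hw, hw'⟩ := ih (fun i => x (i + 1)) fun i hi => h (i + 1) (by omega)
    refine ⟨.cons (h 0 (by omega)) w, by simp [hw], fun i hi => ?_⟩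
    obtain _ | i := i
    · simp
    · simpa using hw' i (by omega)

/-- Shortest open walks are paths, so walks may replace paths; unlike paths, they can be cut and
spliced freely. -/
theorem dSep_iff {u v : V} :
    G.DSep u v C ↔ ∀ n x, IsOpenWalk G C n x → x 0 = u → x n ≠ v := by
  constructor
  · rintro h n x hx rfl rfl
    obtain ⟨m, y, hy, h0, hm⟩ := exists_isShortest hx
    rw [← h0, ← hm] at h
    obtain ⟨w, hw, hw'⟩ := exists_walk_of_adj m y hy.adj
    refine h w ?_ fun i hi => ?_
    · rw [← SimpleGraph.Walk.IsPath.getVert_injOn_iff]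
      intro i hi j hj hij
      simp only [Set.mem_ofPred_eq, hw] at hi hj
      rw [hw' i hi, hw' j hj] at hij
      rcases lt_trichotomy i j with hlt | hlt | hlt
      · exact (hy.ne hlt hj hij).elim
      · exact hlt
      · exact (hy.ne hlt hi hij.symm).elim
    · rw [hw] at hi
      rw [hw' _ (by omega), hw' _ (by omega), hw' _ (by omega)]
      exact hy.openAt i hi
  · intro h w _ hw
    exact h w.length w.getVert ⟨fun i hi => w.adj_getVert_succ hi, hw⟩ (by simp) (by simp)

theorem DSep.symm {u v : V} (h : G.DSep u v C) : G.DSep v u C := by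
  rw [dSep_iff] at h ⊢
  intro n x hx h0 hn
  exact h n _ hx.reverse (by simpa using hn) (by simpa using h0)

theorem DSep.not_adj {u v : V} (h : G.DSep u v C) : ¬ G.skeleton.Adj u v := by
  intro hadj
  rw [dSep_iff] at h
  refine h 1 (fun i => if i = 0 then u else v) ⟨fun i hi => ?_, fun i hi => by omega⟩ rfl rfl
  obtain rfl : i = 0 := by omega
  simpa using hadj

/-- A vertex is separated from its nonadjacent nondescendants by its parents. -/
theorem dSep_parents {u v : V} (hne : u ≠ v) (hadj : ¬ G.skeleton.Adj u v)
    (hdesc : ¬ Relation.TransGen G.edge u v) : G.DSep u v {w | G.edge w u} := by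
  rw [dSep_iff]
  rintro n x hx rfl rfl
  obtain _ | _ | n := n
  · exact hne rfl
  · exact hadj (hx.adj 0 (by omega))
  · rcases hx.adj 0 (by omega) with h | h
    -- Leaving through a child, the walk is directed all the way to the other end, or `x 0` has one
    -- of its own parents as a descendant. Leaving through a parent, it is blocked at that
    -- non-collider.
    · rcases hx.directed_or_reach h (n + 1) (by omega) with ⟨_, h'⟩ | ⟨z, hz, hz'⟩
      · rw [show 0 + 1 + (n + 1) = n + 1 + 1 by omega] at h'
        exact hdesc h'
      · exact not_edge_of_reflTransGen hz' hz
    · exact (hx.openAt 0 (by omega)).2 (fun h' => not_edge_symm h h'.1) h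

/-- The middle vertex of an unshielded triple is a collider exactly if it is absent from the sets
separating the other two. -/
theorem DSep.mem_iff {a r b : V} (h : G.DSep a b C) (har : G.skeleton.Adj a r)
    (hrb : G.skeleton.Adj r b) : r ∈ C ↔ ¬ (G.edge a r ∧ G.edge b r) := by
  have key : ¬ G.OpenAt C a r b := by
    intro ho
    rw [dSep_iff] at h
    refine h 2 (fun i => if i = 0 then a else if i = 1 then r else b)
      ⟨fun i hi => ?_, fun i hi => ?_⟩ rfl rfl
    · interval_cases i
      · simpa using har
      · simpa using hrb
    · obtain rfl : i = 0 := by omega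
      simpa using ho
  constructor
  · intro hr hc
    exact key ⟨fun _ => ⟨r, hr, .refl⟩, fun h' => (h' hc).elim⟩
  · intro hc
    by_contra hr
    exact key ⟨fun h' => (hc h').elim, fun _ => hr⟩

/-! ### Graphs with the same skeleton and the same unshielded colliders -/

/-- The two graphs have the same skeleton and the same unshielded colliders. -/
structure SamePattern (G H : DAG V) : Prop where
  adj : ∀ a b, G.skeleton.Adj a b ↔ H.skeleton.Adj a b
  collider : ∀ a b c, a ≠ c → ¬ G.skeleton.Adj a c →
    (G.edge a b ∧ G.edge c b ↔ H.edge a b ∧ H.edge c b)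

theorem SamePattern.symm (h : SamePattern G H) : SamePattern H G :=
  ⟨fun a b => (h.adj a b).symm,
    fun a b c hac hn => (h.collider a b c hac fun h' => hn ((h.adj a c).1 h')).symm⟩

/-- The vertex `b` has a directed path of length `m` into `C`. -/
def ReachIn (G : DAG V) (C : Set V) : ℕ → V → Prop
  | 0, b => b ∈ C
  | m + 1, b => ∃ d, G.edge b d ∧ ReachIn G C m d

theorem exists_reachIn {b : V} (h : ∃ z ∈ C, Relation.ReflTransGen G.edge b z) :
    ∃ m, ReachIn G C m b := by
  obtain ⟨z, hz, h⟩ := h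
  induction h using Relation.ReflTransGen.head_induction_on with
  | refl => exact ⟨0, hz⟩
  | head hab _ ih =>
    obtain ⟨m, hm⟩ := ih
    exact ⟨m + 1, _, hab, hm⟩

theorem ReachIn.reach {m : ℕ} {b : V} (h : ReachIn G C m b) :
    ∃ z ∈ C, Relation.ReflTransGen G.edge b z := by
  induction m generalizing b with
  | zero => exact ⟨b, h, .refl⟩
  | succ m ih =>
    obtain ⟨d, hbd, hd⟩ := h
    obtain ⟨z, hz, hz'⟩ := ih hd
    exact ⟨z, hz, hz'.head hbd⟩

theorem adj_edge_of_edge_edge {a b c : V} (hab : G.edge a b) (hbc : G.edge b c)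
    (hac : G.skeleton.Adj a c) : G.edge a c := by
  rcases hac with h | h
  · exact h
  · exact (G.acyclic c (((Relation.TransGen.single h).tail hab).tail hbc)).elim

/-- Otherwise `b → d ← e` would be an unshielded collider of `H` alone. -/
theorem SamePattern.edge_of_chain (hGH : SamePattern G H) {b d e : V} (hbd : G.edge b d)
    (hde : G.edge d e) (hbe : ¬ G.skeleton.Adj b e) (hH : H.edge b d) : H.edge d e := by
  have hne : b ≠ e := by
    rintro rfl
    exact not_edge_symm hbd hde
  rcases (hGH.adj d e).1 (Or.inl hde) with h | h
  · exact h
  · exact (not_edge_symm hde ((hGH.collider b d e hne hbe).2 ⟨hH, h⟩).2).elim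

/-- On a shortest directed path into `C` consecutive triples are unshielded, a chord being a
shortcut by acyclicity. So the direction of the first edge in `H` propagates along the path. -/
theorem SamePattern.reach_of_minimal (hGH : SamePattern G H) (m : ℕ) (b d : V) (hbd : G.edge b d)
    (hH : H.edge b d) (hd : ReachIn G C m d) (hmin : ∀ m', m' < m + 1 → ¬ ReachIn G C m' b) :
    ∃ z ∈ C, Relation.ReflTransGen H.edge d z := by
  induction m generalizing b d with
  | zero => exact ⟨d, hd, .refl⟩
  | succ m ih =>
    obtain ⟨e, hde, he⟩ := hd
    have hbe : ¬ G.skeleton.Adj b e := fun h =>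
      hmin (m + 1) (by omega) ⟨e, adj_edge_of_edge_edge hbd hde h, he⟩
    obtain ⟨z, hz, hz'⟩ := ih d e hde (hGH.edge_of_chain hbd hde hbe hH) he
      fun m' hm' h => hmin (m' + 1) (by omega) ⟨d, hbd, h⟩
    exact ⟨z, hz, hz'.head (hGH.edge_of_chain hbd hde hbe hH)⟩

/-- An open unshielded collider can be replaced by one which is open in the other graph. -/
theorem SamePattern.exists_collider (hGH : SamePattern G H) {a c : V} (hac : a ≠ c)
    (hn : ¬ G.skeleton.Adj a c) (m : ℕ) (b : V) (hab : G.edge a b) (hcb : G.edge c b)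
    (hb : ReachIn G C m b) :
    ∃ d, G.edge a d ∧ G.edge c d ∧ (∃ z ∈ C, Relation.ReflTransGen G.edge d z) ∧
      ∃ z ∈ C, Relation.ReflTransGen H.edge d z := by
  induction m using Nat.strong_induction_on generalizing b with
  | _ m ih =>
    by_cases hmin : ∃ m', m' < m ∧ ReachIn G C m' b
    · obtain ⟨m', hm', hb'⟩ := hmin
      exact ih m' hm' b hab hcb hb'
    · obtain _ | m := m
      · exact ⟨b, hab, hcb, hb.reach, b, hb, .refl⟩
      · have hreach := hb.reach
        obtain ⟨d, hbd, hd⟩ := hb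
        -- If `d` is adjacent to both `a` and `c`, it is a collider closer to `C`. Otherwise an
        -- unshielded chain through `b` fixes `b → d` in `H`, and the minimal path carries over.
        by_cases had : G.skeleton.Adj a d ∧ G.skeleton.Adj c d
        · exact ih m (by omega) d (adj_edge_of_edge_edge hab hbd had.1)
            (adj_edge_of_edge_edge hcb hbd had.2) hd
        · have hcol := (hGH.collider a b c hac hn).1 ⟨hab, hcb⟩
          have hH : H.edge b d := by
            by_cases h : G.skeleton.Adj a d
            · exact hGH.edge_of_chain hcb hbd (fun h' => had ⟨h, h'⟩) hcol.2
            · exact hGH.edge_of_chain hab hbd h hcol.1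
          obtain ⟨z, hz, hz'⟩ := hGH.reach_of_minimal m b d hbd hH hd
            fun m' hm' h => hmin ⟨m', hm', h⟩
          exact ⟨b, hab, hcb, hreach, z, hz, hz'.head hH⟩

/-! ### Shielded triples of shortest open walks -/

section Shortest

variable {n : ℕ} {x : ℕ → V}

theorem IsShortest.not_shortcut (h : IsShortest G C n x) {i : ℕ} (hi : i + 2 ≤ n)
    (hadj : G.skeleton.Adj (x i) (x (i + 2)))
    (hl : ∀ j, j + 1 = i → G.OpenAt C (x j) (x i) (x (i + 2)))
    (hr : i + 3 ≤ n → G.OpenAt C (x i) (x (i + 2)) (x (i + 3))) : False := by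
  obtain ⟨y, hy, h0, hm⟩ := h.splice (i := i) (k := 1) hi hadj hl hr
  have := h.le _ _ hy h0 hm
  omega

theorem openAt_of_out_left {a b c d : V} (h : G.OpenAt C a b c) (hbc : G.edge b c)
    (hbd : G.edge b d) : G.OpenAt C a b d :=
  ⟨fun h' => (not_edge_symm hbd h'.2).elim, fun _ => h.2 fun h' => not_edge_symm hbc h'.2⟩

theorem openAt_of_in_left {a b c d : V} (h : G.OpenAt C a b c) (hcb : G.edge c b)
    (hdb : G.edge d b) : G.OpenAt C a b d :=
  ⟨fun h' => h.1 ⟨h'.1, hcb⟩, fun h' => h.2 fun h'' => h' ⟨h''.1, hdb⟩⟩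

theorem openAt_of_out_right {a b c d : V} (h : G.OpenAt C a b c) (hba : G.edge b a)
    (hbd : G.edge b d) : G.OpenAt C d b c :=
  openAt_swap (openAt_of_out_left (openAt_swap h) hba hbd)

theorem openAt_of_in_right {a b c d : V} (h : G.OpenAt C a b c) (hab : G.edge a b)
    (hdb : G.edge d b) : G.OpenAt C d b c :=
  openAt_swap (openAt_of_in_left (openAt_swap h) hab hdb)

/-- The shortcut has the same arrowheads at its ends as the edges it replaces, so it would preserve
openness. -/
theorem IsShortest.not_edge_of_chain (h : IsShortest G C n x) {i : ℕ} (hi : i + 2 ≤ n)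
    (h1 : G.edge (x i) (x (i + 1))) (h2 : G.edge (x (i + 1)) (x (i + 2))) :
    ¬ G.skeleton.Adj (x i) (x (i + 2)) := by
  intro hadj
  have h3 := adj_edge_of_edge_edge h1 h2 hadj
  refine h.not_shortcut hi hadj ?_ fun hn => ?_
  · rintro j rfl
    exact openAt_of_out_left (h.openAt j (by omega)) h1 h3
  · exact openAt_of_in_right (h.openAt (i + 1) (by omega)) h2 h3

/-- The shortcut may turn `x (i + 2)` into a collider, but an open one: its child `x (i + 1)` was an
open collider. -/
theorem IsShortest.not_edge_of_collider (h : IsShortest G C n x) {i : ℕ} (hi : i + 2 ≤ n)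
    (h1 : G.edge (x i) (x (i + 1))) (h2 : G.edge (x (i + 2)) (x (i + 1))) :
    ¬ G.edge (x i) (x (i + 2)) := by
  intro h3
  refine h.not_shortcut hi (Or.inl h3) ?_ fun hn => ?_
  · rintro j rfl
    exact openAt_of_out_left (h.openAt j (by omega)) h1 h3
  · constructor
    · intro _
      obtain ⟨z, hz, hz'⟩ := (h.openAt i hi).1 ⟨h1, h2⟩
      exact ⟨z, hz, hz'.head h2⟩
    · intro _
      exact (h.openAt (i + 1) (by omega)).2 fun h' => not_edge_symm h2 h'.1

/-- The shortcut from `x i` to `x (i + 2)` can fail only at `x i`, which must then be a collider of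
the walk lying in `C`. Were `x j` adjacent to `x (i + 1)`, skipping `x i` would give a shorter open
walk, with `x i ∈ C` opening any collider created at `x j`. -/
theorem IsShortest.exists_collider_of_fork (h : IsShortest G C n x) {i : ℕ} (hi : i + 2 ≤ n)
    (h1 : G.edge (x (i + 1)) (x i)) (h2 : G.edge (x (i + 1)) (x (i + 2)))
    (h3 : G.edge (x i) (x (i + 2))) :
    ∃ j, j + 1 = i ∧ G.edge (x j) (x i) ∧ ¬ G.skeleton.Adj (x j) (x (i + 1)) := by
  by_contra hcon
  push Not at hcon
  refine h.not_shortcut hi (Or.inl h3) ?_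
    fun hn => openAt_of_in_right (h.openAt (i + 1) (by omega)) h2 h3
  rintro j rfl
  have ho := h.openAt j (by omega)
  refine ⟨fun h' => (not_edge_symm h3 h'.2).elim, fun _ hmem => ?_⟩
  by_cases hj : G.edge (x j) (x (j + 1))
  · have hjb := hcon j rfl hj
    refine h.not_shortcut (i := j) (by omega) hjb ?_ fun _ => ?_
    · rintro l rfl
      have hol := h.openAt l (by omega)
      rcases hjb with hjb | hjb
      · exact openAt_of_out_left hol hj hjb
      · exact ⟨fun _ => ⟨_, hmem, .single hj⟩, fun _ => hol.2 fun h' => not_edge_symm hj h'.2⟩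
    · have := (h.openAt (j + 1) hi).2 fun h' => not_edge_symm h1 h'.1
      exact ⟨fun h' => (not_edge_symm h2 h'.2).elim, fun _ => this⟩
  · exact ho.2 (fun h' => hj h'.1) hmem

theorem IsShortest.not_adj_of_collider (h : IsShortest G C n x) {i : ℕ} (hi : i + 2 ≤ n)
    (h1 : G.edge (x i) (x (i + 1))) (h2 : G.edge (x (i + 2)) (x (i + 1))) :
    ¬ G.skeleton.Adj (x i) (x (i + 2)) := by
  rintro (h3 | h3)
  · exact h.not_edge_of_collider hi h1 h2 h3
  · obtain ⟨k, rfl⟩ : ∃ k, n = k + 2 + i := ⟨n - i - 2, by omega⟩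
    have e0 : k + 2 + i - k = i + 2 := by omega
    have e1 : k + 2 + i - (k + 1) = i + 1 := by omega
    have e2 : k + 2 + i - (k + 2) = i := by omega
    refine h.reverse.not_edge_of_collider (i := k) (by omega) ?_ ?_ ?_ <;> simpa [e0, e1, e2]

/-- The colliders of a shortest open walk are the same in both graphs. -/
theorem IsShortest.collider_iff (h : IsShortest G C n x) (hGH : SamePattern G H) {i : ℕ}
    (hi : i + 2 ≤ n) :
    (G.edge (x i) (x (i + 1)) ∧ G.edge (x (i + 2)) (x (i + 1)) ↔
      H.edge (x i) (x (i + 1)) ∧ H.edge (x (i + 2)) (x (i + 1))) := by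
  -- A shielded triple of the walk can only be a fork in `G`. One of its arrows belongs to an
  -- unshielded collider, so it persists in `H` and excludes a collider at the fork's centre.
  have fork : ∀ {n : ℕ} {x : ℕ → V}, IsShortest G C n x → ∀ {i : ℕ}, i + 2 ≤ n →
      G.edge (x (i + 1)) (x i) → G.edge (x (i + 1)) (x (i + 2)) → G.edge (x i) (x (i + 2)) →
      H.edge (x (i + 1)) (x i) := by
    intro n x h i hi h1 h2 h3
    obtain ⟨j, rfl, hj, hadj⟩ := h.exists_collider_of_fork hi h1 h2 h3
    exact ((hGH.collider _ _ _ (h.ne (by omega) (by omega)) hadj).1 ⟨hj, h1⟩).2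
  by_cases hadj : G.skeleton.Adj (x i) (x (i + 2))
  · have hG : ¬ (G.edge (x i) (x (i + 1)) ∧ G.edge (x (i + 2)) (x (i + 1))) := fun h' =>
      h.not_adj_of_collider hi h'.1 h'.2 hadj
    refine iff_of_false hG fun hH => ?_
    obtain ⟨k, rfl⟩ : ∃ k, n = k + 2 + i := ⟨n - i - 2, by omega⟩
    have e0 : k + 2 + i - k = i + 2 := by omega
    have e1 : k + 2 + i - (k + 1) = i + 1 := by omega
    have e2 : k + 2 + i - (k + 2) = i := by omega
    have a1 := h.adj i (by omega)
    have a2 := h.adj (i + 1) (by omega)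
    rcases a1 with a1 | a1 <;> rcases a2 with a2 | a2
    · exact h.not_edge_of_chain hi a1 a2 hadj
    · exact hG ⟨a1, a2⟩
    · rcases hadj with hadj | hadj
      · exact not_edge_symm hH.1 (fork h hi a1 a2 hadj)
      · have := fork h.reverse (i := k) (by omega) (by simpa [e0, e1] using a2)
          (by simpa [e1, e2] using a1) (by simpa [e0, e2] using hadj)
        rw [e0, e1] at this
        exact not_edge_symm hH.2 this
    · refine h.reverse.not_edge_of_chain (i := k) (by omega) ?_ ?_ ?_
      · simpa [e0, e1] using a2
      · simpa [e2, e1] using a1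
      · simpa [e0, e2] using hadj.symm
  · exact hGH.collider _ _ _ (h.ne (by omega) (by omega)) hadj

theorem IsShortest.update (h : IsShortest G C n x) {k : ℕ} (hk : k + 2 ≤ n)
    (h1 : G.edge (x k) (x (k + 1))) (h2 : G.edge (x (k + 2)) (x (k + 1))) {d : V}
    (hd1 : G.edge (x k) d) (hd2 : G.edge (x (k + 2)) d)
    (hd : ∃ z ∈ C, Relation.ReflTransGen G.edge d z) :
    IsShortest G C n (Function.update x (k + 1) d) := by
  have hupd : ∀ j, j ≠ k + 1 → Function.update x (k + 1) d j = x j := fun j hj =>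
    Function.update_of_ne hj _ _
  have hself : Function.update x (k + 1) d (k + 1) = d := Function.update_self _ _ _
  refine ⟨⟨fun i hi => ?_, fun i hi => ?_⟩, fun m y hy h0 hm => ?_⟩
  · by_cases e1 : i = k
    · subst e1
      rw [hself, hupd _ (by omega)]
      exact Or.inl hd1
    · by_cases e2 : i = k + 1
      · subst e2
        rw [hself, hupd _ (by omega)]
        exact Or.inr hd2
      · rw [hupd _ e2, hupd _ (by omega)]
        exact h.adj i hi
  · by_cases e1 : i = k
    · subst e1
      rw [hself, hupd _ (by omega), hupd _ (by omega)]
      exact ⟨fun _ => hd, fun h' => (h' ⟨hd1, hd2⟩).elim⟩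
    · by_cases e2 : i = k + 1
      · subst e2
        rw [hself, hupd _ (by omega), hupd _ (by omega)]
        exact openAt_of_out_right (h.openAt (k + 1) hi) h2 hd2
      · by_cases e3 : i + 1 = k
        · subst e3
          rw [hself, hupd _ (by omega), hupd _ (by omega)]
          exact openAt_of_out_left (h.openAt i hi) h1 hd1
        · rw [hupd _ (by omega), hupd _ (by omega), hupd _ (by omega)]
          exact h.openAt i hi
  · rw [hupd _ (by omega)] at h0 hm
    exact h.le m y hy h0 hm

end Shortest

/-! ### Transfer of open walks and Markov equivalence -/

/-- Colliders are replaced one position at a time. The neighbours of a replaced collider remain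
non-colliders, so positions already treated are not disturbed. -/
theorem SamePattern.exists_isShortest (hGH : SamePattern G H) {n : ℕ} {x : ℕ → V}
    (h : IsShortest G C n x) (K : ℕ) :
    ∃ y, IsShortest G C n y ∧ y 0 = x 0 ∧ y n = x n ∧
      ∀ k, k < K → k + 2 ≤ n → G.edge (y k) (y (k + 1)) → G.edge (y (k + 2)) (y (k + 1)) →
        ∃ z ∈ C, Relation.ReflTransGen H.edge (y (k + 1)) z := by
  induction K with
  | zero => exact ⟨x, h, rfl, rfl, fun k hk => by omega⟩
  | succ K ih =>
    obtain ⟨y, hy, h0, hn, hK⟩ := ih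
    by_cases hc : K + 2 ≤ n ∧ G.edge (y K) (y (K + 1)) ∧ G.edge (y (K + 2)) (y (K + 1))
    · obtain ⟨hKn, h1, h2⟩ := hc
      obtain ⟨m, hm⟩ := exists_reachIn ((hy.openAt K hKn).1 ⟨h1, h2⟩)
      obtain ⟨d, hd1, hd2, hdG, hdH⟩ := hGH.exists_collider (hy.ne (by omega) hKn)
        (hy.not_adj_of_collider hKn h1 h2) m _ h1 h2 hm
      have hupd : ∀ j, j ≠ K + 1 → Function.update y (K + 1) d j = y j := fun j hj =>
        Function.update_of_ne hj _ _
      have hself : Function.update y (K + 1) d (K + 1) = d := Function.update_self _ _ _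
      refine ⟨_, hy.update hKn h1 h2 hd1 hd2 hdG, ?_, ?_, fun k hk hkn hk1 hk2 => ?_⟩
      · rw [hupd _ (by omega), h0]
      · rw [hupd _ (by omega), hn]
      · by_cases e1 : k = K
        · subst e1
          rwa [hself]
        · rw [hupd (k + 1) (by omega)] at hk1 hk2 ⊢
          rw [hupd k (by omega)] at hk1
          by_cases e2 : k + 1 = K
          · subst e2
            rw [hself] at hk2
            exact (not_edge_symm hk2 hd1).elim
          · rw [hupd _ (by omega)] at hk2
            exact hK k (by omega) hkn hk1 hk2
    · refine ⟨y, hy, h0, hn, fun k hk hkn hk1 hk2 => ?_⟩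
      by_cases e : k = K
      · subst e
        exact (hc ⟨hkn, hk1, hk2⟩).elim
      · exact hK k (by omega) hkn hk1 hk2

theorem SamePattern.dSep (hGH : SamePattern G H) {u v : V} (h : H.DSep u v C) : G.DSep u v C := by
  rw [dSep_iff] at h ⊢
  rintro n x hx rfl rfl
  obtain ⟨m, y, hy, hy0, hym⟩ := DAG.exists_isShortest hx
  obtain ⟨z, hz, hz0, hzm, hgood⟩ := hGH.exists_isShortest hy m
  refine h m z ⟨fun i hi => (hGH.adj _ _).1 (hz.adj i hi), fun i hi => ?_⟩ (hz0.trans hy0)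
    (hzm.trans hym)
  have hcol := hz.collider_iff hGH hi
  refine ⟨fun h' => ?_, fun h' => (hz.openAt i hi).2 fun h'' => h' (hcol.1 h'')⟩
  obtain ⟨h1, h2⟩ := hcol.2 h'
  exact hgood i (by omega) hi h1 h2

/-- Graphs with the same skeleton and the same unshielded colliders are Markov equivalent. -/
theorem SamePattern.markovEquiv (hGH : SamePattern G H) : G.MarkovEquiv H :=
  fun _ _ _ _ _ _ => ⟨hGH.symm.dSep, hGH.dSep⟩

theorem exists_dSep {u v : V} (hne : u ≠ v) (hadj : ¬ G.skeleton.Adj u v) :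
    ∃ C, u ∉ C ∧ v ∉ C ∧ G.DSep u v C := by
  by_cases h : Relation.TransGen G.edge u v
  · refine ⟨{w | G.edge w v}, fun h' => hadj (Or.inl h'), fun h' => ne_of_edge h' rfl,
      (dSep_parents hne.symm (fun h' => hadj h'.symm) fun h' => G.acyclic u (h.trans h')).symm⟩
  · exact ⟨{w | G.edge w u}, fun h' => ne_of_edge h' rfl, fun h' => hadj (Or.inr h'),
      dSep_parents hne hadj h⟩

/-- Markov equivalent graphs have the same skeleton and the same unshielded colliders. -/
theorem MarkovEquiv.samePattern (h : G.MarkovEquiv H) : SamePattern G H := by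
  have hadj : ∀ a b, G.skeleton.Adj a b ↔ H.skeleton.Adj a b := by
    intro a b
    by_cases hab : a = b
    · subst hab
      simp
    · constructor
      · intro h1
        by_contra h2
        obtain ⟨C, ha, hb, hC⟩ := exists_dSep hab h2
        exact ((h a b C hab ha hb).2 hC).not_adj h1
      · intro h1
        by_contra h2
        obtain ⟨C, ha, hb, hC⟩ := exists_dSep hab h2
        exact ((h a b C hab ha hb).1 hC).not_adj h1
  refine ⟨hadj, fun a b c hac hn => ?_⟩
  obtain ⟨C, ha, hc, hC⟩ := exists_dSep hac hn
  by_cases hb : G.skeleton.Adj a b ∧ G.skeleton.Adj b c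
  · have h1 := hC.mem_iff hb.1 hb.2
    have h2 := ((h a c C hac ha hc).1 hC).mem_iff ((hadj _ _).1 hb.1) ((hadj _ _).1 hb.2)
    exact not_iff_not.1 (h1.symm.trans h2)
  · refine iff_of_false (fun h' => hb ⟨Or.inl h'.1, Or.inr h'.2⟩) fun h' => hb ⟨?_, ?_⟩
    · exact (hadj _ _).2 (Or.inl h'.1)
    · exact (hadj _ _).2 (Or.inr h'.2)

end DAG

/-! ### Information measures and d-separation -/

theorem condDistrib_map {Ω Ω' α κ : Type*} [MeasurableSpace Ω] [MeasurableSpace Ω']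
    [MeasurableSpace α] [StandardBorelSpace α] [Nonempty α] [MeasurableSpace κ]
    {f : Ω' → α} {h : Ω' → κ} {W : Ω → Ω'} (hf : Measurable f) (hh : Measurable h)
    (hW : Measurable W) (μ : Measure Ω) [IsFiniteMeasure μ] :
    condDistrib f h (μ.map W) = condDistrib (fun ω => f (W ω)) (fun ω => h (W ω)) μ := by
  rw [condDistrib, condDistrib]
  congr 1
  exact Measure.map_map (by fun_prop) hW

/-- The divergence vanishes iff the two laws agree, which is the factorization characterizing
conditional independence. Pushing forward along `W` moves the question to a standard Borel space, a
property not required of `Ω`. -/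
theorem condMutualInfo_eq_zero_iff {Ω Ω' α β κ : Type*} [MeasurableSpace Ω]
    [MeasurableSpace Ω'] [StandardBorelSpace Ω']
    [MeasurableSpace α] [StandardBorelSpace α] [Nonempty α]
    [MeasurableSpace β] [StandardBorelSpace β] [Nonempty β] [MeasurableSpace κ]
    {f : Ω' → α} {g : Ω' → β} {h : Ω' → κ} {W : Ω → Ω'} (hf : Measurable f) (hg : Measurable g)
    (hh : Measurable h) (hW : Measurable W) (μ : Measure Ω) [IsFiniteMeasure μ] :
    condMutualInfo (fun ω => f (W ω)) (fun ω => g (W ω)) (fun ω => h (W ω)) μ = 0 ↔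
      CondIndepFun (MeasurableSpace.comap h inferInstance) hh.comap_le f g (μ.map W) := by
  rw [condIndepFun_iff_map_prod_eq_prod_condDistrib_prod_condDistrib hf hg hh,
    ← Measure.compProd_eq_comp_prod, condMutualInfo, klDiv_eq_zero_iff]
  rw [condDistrib_map hf hh hW, condDistrib_map hg hh hW, Measure.map_map (by fun_prop) hW,
    Measure.map_map hh hW]
  rfl

section

variable {ι Ω : Type*} [MeasurableSpace Ω] {μ : Measure Ω} [IsFiniteMeasure μ]
  {X : ι → ℤ → Ω → ℝ} {t : ℤ} {γ : ℕ} {G : DAG (Node ι)}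

theorem measurable_nodeVar (hX : ∀ p s, Measurable (X p s)) (t : ℤ) (γ : ℕ) :
    Measurable fun ω (v : Node ι) => nodeVar X t γ v ω :=
  measurable_pi_lambda _ fun _ => measurable_pi_lambda _ fun _ => hX _ _

variable [Fintype ι]

theorem Faithful.condMutualInfo_eq_zero_iff (hX : ∀ p s, Measurable (X p s))
    (hfaithful : Faithful (jointLaw X t γ μ) G) {u v : Node ι} {R : Finset (Node ι)} (huv : u ≠ v)
    (hu : u ∉ R) (hv : v ∉ R) :
    condMutualInfo (nodeVar X t γ u) (nodeVar X t γ v) (nodeVars X t γ R) μ = 0 ↔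
      G.DSep u v R := by
  rw [← hfaithful u v R huv hu hv]
  exact PCGCE.condMutualInfo_eq_zero_iff (W := fun ω (v : Node ι) => nodeVar X t γ v ω)
    (measurable_pi_apply u) (measurable_pi_apply v)
    (measurable_restrict γ R) (measurable_nodeVar hX t γ) μ

theorem Faithful.testedIndep_iff (hX : ∀ p s, Measurable (X p s))
    (hfaithful : Faithful (jointLaw X t γ μ) G) {u v : Node ι} {R : Finset (Node ι)}
    (huv : (initialGraph ι).Adj u v) (hu : u ∉ R) (hv : v ∉ R) :
    TestedIndep X t γ μ u v R ↔ G.DSep u v R := by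
  have hne := huv.1
  have key := hfaithful.condMutualInfo_eq_zero_iff hX hne hu hv
  have key' := hfaithful.condMutualInfo_eq_zero_iff hX hne.symm hv hu
  constructor
  · rintro (⟨p, q, _, h⟩ | ⟨p, q, _, h⟩ | ⟨p, q, _, h⟩)
    · exact (key'.1 h).symm
    · exact key.1 h
    · exact key.1 h
  · intro h
    rcases u with p | p <;> rcases v with q | q
    · exact (huv.2 ⟨rfl, rfl⟩).elim
    · exact .past_present _ _ _ (key'.2 h.symm)
    · exact .present_past _ _ _ (key.2 h)
    · exact .present_present _ _ _ (key.2 h)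

end

/-! ### Perfect orderings -/

section PerfectOrder

variable {V : Type*} {S : SimpleGraph V}

/-- The vertices of `A` before `z` in the order given by `f` that are neighbours of `z` are
adjacent to one another. -/
def IsPerfectOn (S : SimpleGraph V) (A : Finset V) (f : V → ℕ) : Prop :=
  ∀ x ∈ A, ∀ y ∈ A, ∀ z ∈ A, f x < f z → f y < f z → S.Adj x z → S.Adj y z → x ≠ y → S.Adj x y

/-- The neighbours of `z` in `A` are adjacent to one another. -/
def IsSimplicialIn (S : SimpleGraph V) (A : Finset V) (z : V) : Prop :=
  ∀ x ∈ A, ∀ y ∈ A, S.Adj x z → S.Adj y z → x ≠ y → S.Adj x y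

theorem IsPerfectOn.mono {A B : Finset V} {f : V → ℕ} (h : IsPerfectOn S A f) (hBA : B ⊆ A) :
    IsPerfectOn S B f := fun x hx y hy z hz =>
  h x (hBA hx) y (hBA hy) z (hBA hz)

/-- Dirac's lemma for chordal graphs. The last vertex `v` is simplicial; of two nonadjacent
simplicial vertices of the remainder, one is not adjacent to `v`, hence stays simplicial and pairs
with `v`. -/
theorem IsPerfectOn.clique_or_simplicial {f : V → ℕ} (hf : Function.Injective f) (A : Finset V)
    (h : IsPerfectOn S A f) :
    (∀ x ∈ A, ∀ y ∈ A, x ≠ y → S.Adj x y) ∨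
      ∃ a ∈ A, ∃ b ∈ A, a ≠ b ∧ ¬ S.Adj a b ∧ IsSimplicialIn S A a ∧ IsSimplicialIn S A b := by
  classical
  induction hn : A.card generalizing A with
  | zero =>
    rw [Finset.card_eq_zero] at hn
    subst hn
    simp
  | succ n ih =>
    obtain ⟨v, hv, hmax⟩ := A.exists_max_image f (Finset.card_pos.1 (by omega))
    have hlt : ∀ x ∈ A, x ≠ v → f x < f v := fun x hx hxv =>
      (hmax x hx).lt_of_ne fun e => hxv (hf e)
    have hsv : IsSimplicialIn S A v := fun x hx y hy hxv hyv =>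
      h x hx y hy v hv (hlt x hx hxv.ne) (hlt y hy hyv.ne) hxv hyv
    have hmem : ∀ {x}, x ∈ A → x ≠ v → x ∈ A.erase v := fun hx hxv =>
      Finset.mem_erase.2 ⟨hxv, hx⟩
    have hlift : ∀ {x}, x ∈ A → x ≠ v → ¬ S.Adj x v → IsSimplicialIn S (A.erase v) x →
        ∃ a ∈ A, ∃ b ∈ A, a ≠ b ∧ ¬ S.Adj a b ∧ IsSimplicialIn S A a ∧ IsSimplicialIn S A b := by
      intro x hx hxv hadj hsx
      refine ⟨x, hx, v, hv, hxv, hadj, fun y hy z hz hyx hzx => ?_, hsv⟩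
      refine hsx y (hmem hy ?_) z (hmem hz ?_) hyx hzx
      · rintro rfl
        exact hadj hyx.symm
      · rintro rfl
        exact hadj hzx.symm
    rcases ih (A.erase v) (h.mono (Finset.erase_subset v A))
      (by rw [Finset.card_erase_of_mem hv]; omega) with hc | ⟨a, ha, b, hb, hab, hadj, hsa, hsb⟩
    · by_cases hall : ∀ x ∈ A, x ≠ v → S.Adj x v
      · left
        intro x hx y hy hxy
        by_cases hxv : x = v
        · subst hxv
          exact (hall y hy hxy.symm).symm
        · by_cases hyv : y = v
          · subst hyv
            exact hall x hx hxy
          · exact hc x (hmem hx hxv) y (hmem hy hyv) hxy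
      · push Not at hall
        obtain ⟨x, hx, hxv, hadj⟩ := hall
        exact Or.inr (hlift hx hxv hadj fun y hy z hz _ _ => hc y hy z hz)
    · right
      rw [Finset.mem_erase] at ha hb
      by_cases h1 : S.Adj a v
      · by_cases h2 : S.Adj b v
        · exact (hadj (hsv a ha.2 b hb.2 h1 h2 hab)).elim
        · exact hlift hb.2 hb.1 h2 hsb
      · exact hlift ha.2 ha.1 h1 hsa

/-- A graph with a perfect ordering has a perfect ordering that starts at a given vertex. -/
theorem IsPerfectOn.exists_root {f : V → ℕ} (hf : Function.Injective f) (v : V) (A : Finset V)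
    (hv : v ∈ A) (h : IsPerfectOn S A f) :
    ∃ g : V → ℕ, Set.InjOn g A ∧ IsPerfectOn S A g ∧ ∀ x ∈ A, x ≠ v → g v < g x := by
  classical
  induction hn : A.card generalizing A with
  | zero =>
    rw [Finset.card_eq_zero] at hn
    simp [hn] at hv
  | succ n ih =>
    by_cases hA : ∃ w ∈ A, w ≠ v
    · obtain ⟨s, hs, hsv, hsimp⟩ : ∃ s ∈ A, s ≠ v ∧ IsSimplicialIn S A s := by
        rcases h.clique_or_simplicial hf with hc | ⟨a, ha, b, hb, hab, _, hsa, hsb⟩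
        · obtain ⟨w, hw, hwv⟩ := hA
          exact ⟨w, hw, hwv, fun x hx y hy _ _ => hc x hx y hy⟩
        · by_cases hav : a = v
          · exact ⟨b, hb, fun hbv => hab (hav.trans hbv.symm), hsb⟩
          · exact ⟨a, ha, hav, hsa⟩
      obtain ⟨g, hg, hperf, hmin⟩ := ih (A.erase s) (Finset.mem_erase.2 ⟨hsv.symm, hv⟩)
        (h.mono (Finset.erase_subset s A)) (by rw [Finset.card_erase_of_mem hs]; omega)
      have hself : Function.update g s (A.sup g + 1) s = A.sup g + 1 := Function.update_self _ _ _
      have hupd : ∀ x, x ≠ s → Function.update g s (A.sup g + 1) x = g x := fun x hx =>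
        Function.update_of_ne hx _ _
      have hlt : ∀ x ∈ A, g x < A.sup g + 1 := fun x hx => Nat.lt_succ_of_le (Finset.le_sup hx)
      have hmem : ∀ {x}, x ∈ A → x ≠ s → x ∈ A.erase s := fun hx hxs =>
        Finset.mem_erase.2 ⟨hxs, hx⟩
      have hle : ∀ x ∈ A, Function.update g s (A.sup g + 1) x ≤ A.sup g + 1 := by
        intro x hx
        by_cases hxs : x = s
        · rw [hxs, hself]
        · rw [hupd x hxs]
          exact (hlt x hx).le
      refine ⟨Function.update g s (A.sup g + 1), fun x hx y hy hxy => ?_,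
        fun x hx y hy z hz hxz hyz => ?_, fun x hx hxv => ?_⟩
      · by_cases hxs : x = s <;> by_cases hys : y = s
        · rw [hxs, hys]
        · rw [hxs, hself, hupd y hys] at hxy
          exact ((hlt y hy).ne hxy.symm).elim
        · rw [hys, hself, hupd x hxs] at hxy
          exact ((hlt x hx).ne hxy).elim
        · rw [hupd x hxs, hupd y hys] at hxy
          exact hg (hmem hx hxs) (hmem hy hys) hxy
      · by_cases hzs : z = s
        · subst hzs
          exact hsimp x hx y hy
        · have hne : ∀ w, Function.update g s (A.sup g + 1) w <
              Function.update g s (A.sup g + 1) z → w ≠ s := by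
            rintro w hw rfl
            rw [hself] at hw
            exact (hle z hz).not_gt hw
          have hxs := hne x hxz
          have hys := hne y hyz
          rw [hupd x hxs, hupd z hzs] at hxz
          rw [hupd y hys, hupd z hzs] at hyz
          exact hperf x (hmem hx hxs) y (hmem hy hys) z (hmem hz hzs) hxz hyz
      · rw [hupd v hsv.symm]
        by_cases hxs : x = s
        · rw [hxs, hself]
          exact hlt v hv
        · rw [hupd x hxs]
          exact hmin x (hmem hx hxs) hxv
    · push Not at hA
      exact ⟨f, hf.injOn, h, fun x hx hxv => (hxv (hA x hx)).elim⟩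

end PerfectOrder

/-- A finite directed acyclic graph has a topological ordering. -/
theorem DAG.exists_topological {V : Type*} [Finite V] (G : DAG V) :
    ∃ f : V → ℕ, Function.Injective f ∧ ∀ u v, G.edge u v → f u < f v := by
  classical
  let := Fintype.ofFinite V
  let anc : V → Finset V := fun v => Finset.univ.filter fun w => Relation.TransGen G.edge w v
  let e := Fintype.equivFin V
  have hlt : ∀ v, (e v : ℕ) < Fintype.card V := fun v => (e v).2
  -- The number of ancestors grows strictly along edges; the index `e v` only breaks ties.
  refine ⟨fun v => (anc v).card * Fintype.card V + e v, fun u v huv => ?_, fun u v huv => ?_⟩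
  · have := congrArg (· % Fintype.card V) huv
    simp only [Nat.mul_add_mod', Nat.mod_eq_of_lt (hlt _)] at this
    exact e.injective (Fin.ext this)
  · have hcard : (anc u).card < (anc v).card := by
      refine Finset.card_lt_card ⟨fun w hw => ?_, fun hsub => ?_⟩
      · simp only [anc, Finset.mem_filter, Finset.mem_univ, true_and] at hw ⊢
        exact hw.tail huv
      · have hu : u ∈ anc v := by
          simp only [anc, Finset.mem_filter, Finset.mem_univ, true_and]
          exact .single huv
        have := hsub hu
        simp only [anc, Finset.mem_filter, Finset.mem_univ, true_and] at this
        exact G.acyclic u this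
    calc (anc u).card * Fintype.card V + e u < ((anc u).card + 1) * Fintype.card V := by
          rw [add_one_mul]
          exact Nat.add_lt_add_left (hlt u) _
      _ ≤ (anc v).card * Fintype.card V := Nat.mul_le_mul_right _ hcard
      _ ≤ (anc v).card * Fintype.card V + e v := Nat.le_add_right _ _

/-! ### Correctness of the skeleton construction -/

theorem IsExtendedSummary.skeleton_le {ι : Type*} {G : DAG (Node ι)} (hG : IsExtendedSummary G) :
    G.skeleton ≤ initialGraph ι := by
  intro u v h
  refine ⟨h.ne, fun h' => ?_⟩
  rcases u with p | p <;> rcases v with q | q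
  · rcases h with h | h
    · exact hG _ _ h
    · exact hG _ _ h
  all_goals simp at h'

/-- The state `s` is compatible with `G`: no edge of `G` has been removed, and the recorded sets
separate the endpoints of the removed edges. -/
structure SkelInv {ι : Type*} (G : DAG (Node ι)) (s : SkelState ι) : Prop where
  le : G.skeleton ≤ s.graph
  le_initial : s.graph ≤ initialGraph ι
  sep : ∀ u v, (initialGraph ι).Adj u v → ¬ s.graph.Adj u v →
    G.DSep u v (s.sepset s(u, v))

section

variable {ι Ω : Type*} [MeasurableSpace Ω] {X : ι → ℤ → Ω → ℝ} {t : ℤ} {γ : ℕ} {μ : Measure Ω}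
  [IsFiniteMeasure μ] {G : DAG (Node ι)}

theorem performTest_graph_le (s : SkelState ι) (T : Node ι × Node ι × Finset (Node ι)) :
    (performTest X t γ μ s T).graph ≤ s.graph := by
  unfold performTest
  split_ifs
  · exact SimpleGraph.deleteEdges_le _
  · exact le_rfl

theorem foldl_performTest_graph_le (L : List (Node ι × Node ι × Finset (Node ι)))
    (s : SkelState ι) : (L.foldl (performTest X t γ μ) s).graph ≤ s.graph := by
  induction L generalizing s with
  | nil => exact le_rfl
  | cons T L ih => exact (ih _).trans (performTest_graph_le s T)

theorem not_adj_performTest (s : SkelState ι) {T : Node ι × Node ι × Finset (Node ι)}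
    (h : TestedIndep X t γ μ T.1 T.2.1 T.2.2) :
    ¬ (performTest X t γ μ s T).graph.Adj T.1 T.2.1 := by
  unfold performTest
  split_ifs with h'
  · simp
  · exact fun h'' => h' ⟨h'', h⟩

theorem not_adj_foldl_performTest (L : List (Node ι × Node ι × Finset (Node ι)))
    (s : SkelState ι) {T : Node ι × Node ι × Finset (Node ι)} (hT : T ∈ L)
    (h : TestedIndep X t γ μ T.1 T.2.1 T.2.2) :
    ¬ (L.foldl (performTest X t γ μ) s).graph.Adj T.1 T.2.1 := by
  induction L generalizing s with
  | nil => simp at hT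
  | cons T' L ih =>
    rcases List.mem_cons.1 hT with rfl | hT
    · exact fun h' => not_adj_performTest s h (foldl_performTest_graph_le L _ h')
    · exact ih _ hT

/-- The tests decide d-separation in `G`. -/
def TestsDecide (X : ι → ℤ → Ω → ℝ) (t : ℤ) (γ : ℕ) (μ : Measure Ω) [IsFiniteMeasure μ]
    (G : DAG (Node ι)) : Prop :=
  ∀ (u v : Node ι) (R : Finset (Node ι)), (initialGraph ι).Adj u v → u ∉ R → v ∉ R →
    (TestedIndep X t γ μ u v R ↔ G.DSep u v R)

theorem SkelInv.performTest (htest : TestsDecide X t γ μ G) {s : SkelState ι} (h : SkelInv G s)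
    {T : Node ι × Node ι × Finset (Node ι)} (h1 : T.1 ∉ T.2.2) (h2 : T.2.1 ∉ T.2.2) :
    SkelInv G (performTest X t γ μ s T) := by
  classical
  obtain ⟨a, b, R⟩ := T
  unfold PCGCE.performTest
  split_ifs with hT
  · obtain ⟨hadj, hind⟩ := hT
    dsimp only at hadj hind h1 h2
    have hsep := (htest a b R (h.le_initial hadj) h1 h2).1 hind
    refine ⟨fun u v huv => ?_, (SimpleGraph.deleteEdges_le _).trans h.le_initial,
      fun u v huv hnot => ?_⟩
    · rw [SimpleGraph.deleteEdges_adj]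
      refine ⟨h.le huv, fun he => ?_⟩
      rcases Sym2.eq_iff.1 (Set.mem_singleton_iff.1 he) with ⟨rfl, rfl⟩ | ⟨rfl, rfl⟩
      · exact hsep.not_adj huv
      · exact hsep.symm.not_adj huv
    · by_cases he : s(u, v) = s(a, b)
      · dsimp only
        rw [he, Function.update_self]
        rcases Sym2.eq_iff.1 he with ⟨rfl, rfl⟩ | ⟨rfl, rfl⟩
        · exact hsep
        · exact hsep.symm
      · dsimp only
        rw [Function.update_of_ne he]
        refine h.sep u v huv fun h' => hnot ?_
        rw [SimpleGraph.deleteEdges_adj]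
        exact ⟨h', fun h'' => he h''⟩
  · exact h

theorem SkelInv.foldl (htest : TestsDecide X t γ μ G)
    (L : List (Node ι × Node ι × Finset (Node ι))) {s : SkelState ι} (h : SkelInv G s)
    (hL : ∀ T ∈ L, T.1 ∉ T.2.2 ∧ T.2.1 ∉ T.2.2) :
    SkelInv G (L.foldl (PCGCE.performTest X t γ μ) s) := by
  induction L generalizing s with
  | nil => exact h
  | cons T L ih =>
    have hT := hL T List.mem_cons_self
    exact ih (h.performTest htest hT.1 hT.2) fun T' hT' => hL T' (List.mem_cons_of_mem _ hT')

theorem IsTest.not_mem {S : SimpleGraph (Node ι)} {n : ℕ}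
    {T : Node ι × Node ι × Finset (Node ι)} (h : IsTest S n T) :
    T.1 ∉ T.2.2 ∧ T.2.1 ∉ T.2.2 := by
  rcases h.2.2 with h' | h'
  · exact ⟨fun hm => S.irrefl (h' _ hm).1, fun hm => (h' _ hm).2 rfl⟩
  · exact ⟨fun hm => (h' _ hm).2 rfl, fun hm => S.irrefl (h' _ hm).1⟩

theorem SkelRun.inv (hG : IsExtendedSummary G) (htest : TestsDecide X t γ μ G) {n : ℕ}
    {s : SkelState ι} (h : SkelRun X t γ μ n s) : SkelInv G s := by
  induction h with
  | init => exact ⟨hG.skeleton_le, le_rfl, fun u v h h' => (h' h).elim⟩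
  | level n s L _ hL ih => exact ih.foldl htest L fun T hT => ((hL T).1 hT).not_mem

/-- Pairs that are separated by the parents of one of them are no longer adjacent when all sets
of the size of this set of parents have been tested. -/
theorem SkelRun.not_adj (hG : IsExtendedSummary G) (htest : TestsDecide X t γ μ G) {n : ℕ}
    {s : SkelState ι} (h : SkelRun X t γ μ n s) (u v : Node ι) (P : Finset (Node ι))
    (hP : ∀ w, w ∈ P ↔ G.edge w u) (hsep : G.DSep u v P) (hn : P.card < n) :
    ¬ s.graph.Adj u v := by
  induction h with
  | init => omega
  | level n s L hs hL ih =>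
    intro hadj
    have hinv := hs.inv hG htest
    have hadj' := foldl_performTest_graph_le L s hadj
    rcases (Nat.lt_succ_iff.1 hn).lt_or_eq with hlt | heq
    · exact ih hlt hadj'
    · have hv : v ∉ P := fun h' => hsep.not_adj (Or.inr ((hP v).1 h'))
      -- The parents of `u` are still its neighbours because no edge of `G` has been removed.
      have hT : IsTest s.graph n (u, v, P) := by
        refine ⟨hadj', heq, Or.inl fun w hw => ⟨hinv.le (Or.inr ((hP w).1 hw)), ?_⟩⟩
        rintro rfl
        exact hv hw
      exact not_adj_foldl_performTest L s ((hL _).2 hT)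
        ((htest u v P (hinv.le_initial hadj') hT.not_mem.1 hv).2 hsep) hadj

theorem SkelRun.graph_eq [Fintype ι] (hG : IsExtendedSummary G) (htest : TestsDecide X t γ μ G)
    {s : SkelState ι} (h : SkelRun X t γ μ (Fintype.card (Node ι)) s) :
    s.graph = G.skeleton := by
  classical
  refine le_antisymm (fun u v huv => ?_) (h.inv hG htest).le
  by_contra hnot
  -- A superfluous edge would make each endpoint a descendant of the other. The parents of `a` omit
  -- `a`, so their number is below the number of levels.
  have key : ∀ a b, a ≠ b → ¬ G.skeleton.Adj a b → s.graph.Adj a b →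
      Relation.TransGen G.edge a b := by
    intro a b hab hadj hs
    by_contra hdesc
    let P : Finset (Node ι) := Finset.univ.filter fun w => G.edge w a
    have hP : ∀ w, w ∈ P ↔ G.edge w a := fun w => by simp [P]
    have hcoe : (P : Set (Node ι)) = {w | G.edge w a} := by
      ext w
      simp [P]
    refine h.not_adj hG htest a b P hP ?_ ?_ hs
    · rw [hcoe]
      exact DAG.dSep_parents hab hadj hdesc
    · exact Finset.card_lt_univ_of_notMem (x := a) fun h' => DAG.ne_of_edge ((hP a).1 h') rfl
  exact G.acyclic u ((key u v huv.ne hnot huv).trans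
    (key v u huv.ne.symm (fun h' => hnot h'.symm) huv.symm))

theorem exists_skelRun [Fintype ι] (X : ι → ℤ → Ω → ℝ) (t : ℤ) (γ : ℕ) (μ : Measure Ω)
    [IsFiniteMeasure μ] (n : ℕ) : ∃ s, SkelRun X t γ μ n s := by
  classical
  induction n with
  | zero => exact ⟨_, .init⟩
  | succ n ih =>
    obtain ⟨s, hs⟩ := ih
    exact ⟨_, .level n s (Finset.univ.filter (IsTest s.graph n)).toList hs fun T => by simp⟩

end

/-! ### Soundness and completeness of the orientation rules -/

section Orientation

variable {ι : Type*} {G H : DAG (Node ι)} {s : SkelState ι} {D : Node ι → Node ι → Prop}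

/-- The state `s` holds the skeleton of `G` and sets separating its nonadjacent vertices. -/
structure IsSkeletonOf (G : DAG (Node ι)) (s : SkelState ι) : Prop where
  graph_eq : s.graph = G.skeleton
  sep : ∀ u v, (initialGraph ι).Adj u v → ¬ G.skeleton.Adj u v → G.DSep u v (s.sepset s(u, v))

theorem IsSkeletonOf.collider_of_notMem (hs : IsSkeletonOf G s) {a r b : Node ι}
    (hab : (initialGraph ι).Adj a b) (hn : ¬ s.graph.Adj a b) (har : s.graph.Adj a r)
    (hrb : s.graph.Adj r b) (hr : r ∉ s.sepset s(a, b)) : G.edge a r ∧ G.edge b r := by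
  rw [hs.graph_eq] at hn har hrb
  by_contra hc
  exact hr (((hs.sep a b hab hn).mem_iff har hrb).2 hc)

theorem IsSkeletonOf.notMem_of_collider (hs : IsSkeletonOf G s) {a r b : Node ι}
    (hab : (initialGraph ι).Adj a b) (hn : ¬ G.skeleton.Adj a b) (ha : G.edge a r)
    (hb : G.edge b r) : r ∉ s.sepset s(a, b) := fun hr =>
  ((hs.sep a b hab hn).mem_iff (Or.inl ha) (Or.inr hb)).1 hr ⟨ha, hb⟩

/-- Two past vertices have no recorded separating set and need none: temporal priority already
supplies their arrows. -/
theorem IsSkeletonOf.initArrow_of_collider (hs : IsSkeletonOf G s) (hG : IsExtendedSummary G)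
    {a b c : Node ι} (hac : a ≠ c) (hn : ¬ G.skeleton.Adj a c) (hab : G.edge a b)
    (hcb : G.edge c b) : InitArrow s a b := by
  have ha : s.graph.Adj a b := by
    rw [hs.graph_eq]
    exact Or.inl hab
  have hc : s.graph.Adj c b := by
    rw [hs.graph_eq]
    exact Or.inl hcb
  have hn' : ¬ s.graph.Adj a c := by rwa [hs.graph_eq]
  rcases b with r | r
  · exact (hG _ _ hab).elim
  rcases a with p | p
  · exact .temporal p r ha
  rcases c with q | q
  · exact .collider_past p r q ha hc (fun h => hn' h.symm)
      (hs.notMem_of_collider ⟨hac.symm, by simp⟩ (fun h => hn h.symm) hcb hab)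
  · exact .collider_present p r q (fun h => hac (congrArg _ h)) ha hc hn'
      (hs.notMem_of_collider ⟨hac, by simp⟩ hn hab hcb)

theorem IsSkeletonOf.initArrow_cases (hs : IsSkeletonOf G s) {a b : Node ι}
    (h : InitArrow s a b) : (∃ p, a = past p) ∨
      ∃ d, a ≠ d ∧ ¬ G.skeleton.Adj a d ∧ G.edge a b ∧ G.edge d b := by
  rcases h with ⟨p, q, _⟩ | ⟨p, r, q, hpq, hp, hq, h, hr⟩ | ⟨p, r, q, hp, hq, h, hr⟩
  · exact Or.inl ⟨p, rfl⟩
  · have hne : (present p : Node ι) ≠ present q := fun h => hpq (Sum.inr_injective h)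
    have hc := hs.collider_of_notMem ⟨hne, by simp⟩ h hp hq.symm hr
    rw [hs.graph_eq] at h
    exact Or.inr ⟨_, hne, h, hc⟩
  · have hc := hs.collider_of_notMem ⟨by simp, by simp⟩ h hq hp.symm hr
    rw [hs.graph_eq] at h
    exact Or.inr ⟨past q, by simp, fun h' => h h'.symm, hc.symm⟩

theorem IsSkeletonOf.initArrow_edge (hs : IsSkeletonOf G s) (hGH : DAG.SamePattern G H)
    (hH : IsExtendedSummary H) {a b : Node ι} (h : InitArrow s a b) : H.edge a b := by
  have hadj : s.graph.Adj a b := by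
    rcases h with ⟨_, _, h⟩ | ⟨_, _, _, _, h, _⟩ | ⟨_, _, _, h, _⟩ <;> exact h
  rw [hs.graph_eq, hGH.adj] at hadj
  rcases hs.initArrow_cases h with ⟨p, rfl⟩ | ⟨d, hne, hn, hab, hdb⟩
  · rcases hadj with h | h
    · exact h
    · exact (hH _ _ h).elim
  · exact ((hGH.collider a b d hne hn).1 ⟨hab, hdb⟩).1

theorem Unoriented.symm {u v : Node ι} (h : Unoriented s D u v) : Unoriented s D v u :=
  ⟨h.1.symm, h.2.2, h.2.1⟩

/-- The opposite direction would create, respectively, an unshielded collider contradicting the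
separating set, a directed cycle, or an unshielded collider at `p` whose arrows would already be
initial. -/
theorem IsSkeletonOf.orientRule_edge (hs : IsSkeletonOf G s) (hG : IsExtendedSummary G)
    (hGH : DAG.SamePattern G H) (hinit : ∀ a b, InitArrow s a b → D a b)
    (hD : ∀ a b, D a b → H.edge a b) {u v : Node ι} (h : OrientRule s D u v) : H.edge u v := by
  have hadj : ∀ {a b}, s.graph.Adj a b → H.skeleton.Adj a b := fun {a b} h' =>
    (hGH.adj a b).1 (hs.graph_eq ▸ h')
  rcases h with ⟨u, r, q, hur, hrq, hne, hn, hr⟩ | ⟨p, q, h, hpq⟩ |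
    ⟨p, q, r, r', hpq, hpr, hrq, hpr', hrq', hne, hn⟩
  · rcases hadj hrq.1 with h | h
    · exact h
    · rw [hs.graph_eq] at hn
      have hc := (hGH.collider _ _ _ hne hn).2 ⟨hD _ _ hur, h⟩
      exact (hs.notMem_of_collider ⟨hne, by simp⟩ hn hc.1 hc.2 hr).elim
  · rcases hadj hpq.1 with h' | h'
    · exact h'
    · have : Relation.TransGen H.edge (present p) (present q) :=
        Relation.TransGen.mono hD _ _ h
      exact (H.acyclic _ (this.tail h')).elim
  · rcases hadj hpq.1 with h' | h'
    · exact h'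
    · have h1 := DAG.adj_edge_of_edge_edge (hD _ _ hrq) h' (hadj hpr.1).symm
      have h2 := DAG.adj_edge_of_edge_edge (hD _ _ hrq') h' (hadj hpr'.1).symm
      have hne' : (present r : Node ι) ≠ present r' := fun e => hne (Sum.inr_injective e)
      rw [hs.graph_eq] at hn
      have hc := (hGH.collider _ _ _ hne' hn).2 ⟨h1, h2⟩
      exact (hpr.2.2 (hinit _ _ (hs.initArrow_of_collider hG hne' hn hc.1 hc.2))).elim

theorem initArrow_le (h : Relation.ReflTransGen (OrientStep s) (InitArrow s) D) {a b : Node ι}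
    (hab : InitArrow s a b) : D a b := by
  induction h with
  | refl => exact hab
  | tail _ hstep ih =>
    obtain ⟨u, v, _, rfl⟩ := hstep
    exact Or.inl ih

/-- All arrows are contained in every extended summary graph with the same pattern. -/
theorem IsSkeletonOf.arrow_edge (hs : IsSkeletonOf G s) (hG : IsExtendedSummary G)
    (hGH : DAG.SamePattern G H) (hH : IsExtendedSummary H)
    (h : Relation.ReflTransGen (OrientStep s) (InitArrow s) D) {a b : Node ι} (hab : D a b) :
    H.edge a b := by
  induction h generalizing a b with
  | refl => exact hs.initArrow_edge hGH hH hab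
  | tail hrun hstep ih =>
    obtain ⟨u, v, hrule, rfl⟩ := hstep
    rcases hab with hab | ⟨rfl, rfl⟩
    · exact ih hab
    · exact hs.orientRule_edge hG hGH (fun _ _ => initArrow_le hrun) (fun _ _ => ih) hrule

/-! ### Completeness of the orientation rules -/

/-- The arrows `D` are correct for `G`, contain the initial arrows and are closed under the
orientation rules. -/
structure IsClosedUnderRules (G : DAG (Node ι)) (s : SkelState ι) (D : Node ι → Node ι → Prop) :
    Prop where
  init_le : ∀ a b, InitArrow s a b → D a b
  edge : ∀ a b, D a b → G.edge a b
  adj : ∀ a b c, D a b → Unoriented s D b c → G.skeleton.Adj a c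
  not_path : ∀ a b, Relation.TransGen D a b → ¬ Unoriented s D a b
  not_two_paths : ∀ a b r r', Unoriented s D a b → Unoriented s D a r → D r b →
    Unoriented s D a r' → D r' b → r ≠ r' → G.skeleton.Adj r r'

theorem IsSkeletonOf.present_of_unoriented (hs : IsSkeletonOf G s) (hG : IsExtendedSummary G)
    (hinit : ∀ a b, InitArrow s a b → D a b) {u v : Node ι} (h : Unoriented s D u v) :
    ∃ p q, u = present p ∧ v = present q := by
  have hadj := h.1
  rw [hs.graph_eq] at hadj
  have hle := hG.skeleton_le hadj
  rcases u with p | p <;> rcases v with q | q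
  · exact (hle.2 ⟨rfl, rfl⟩).elim
  · exact (h.2.1 (hinit _ _ (.temporal p q h.1))).elim
  · exact (h.2.2 (hinit _ _ (.temporal q p h.1.symm))).elim
  · exact ⟨p, q, rfl, rfl⟩

theorem IsSkeletonOf.isClosedUnderRules (hs : IsSkeletonOf G s) (hG : IsExtendedSummary G)
    (h : Relation.ReflTransGen (OrientStep s) (InitArrow s) D)
    (hclosed : ∀ u v, ¬ OrientRule s D u v) : IsClosedUnderRules G s D := by
  have hinit : ∀ a b, InitArrow s a b → D a b := fun _ _ => initArrow_le h
  have hedge : ∀ a b, D a b → G.edge a b := fun _ _ =>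
    hs.arrow_edge hG ⟨fun _ _ => Iff.rfl, fun _ _ _ _ _ => Iff.rfl⟩ hG h
  refine ⟨hinit, hedge, fun a b c hab hbc => ?_, fun a b hab hun => ?_,
    fun a b r r' hab har hrb har' hrb' hne => ?_⟩
  · obtain ⟨r, q, rfl, rfl⟩ := hs.present_of_unoriented hG hinit hbc
    by_contra hn
    have hne : a ≠ present q := by
      rintro rfl
      exact hbc.2.2 hab
    -- Outside the separating set, `r` would be an unshielded collider, and its initial arrows would
    -- orient the edge to `q`.
    by_cases hr : present r ∈ s.sepset s(a, present q)
    · exact hclosed _ _ (.propagation a r q hab hbc hne (by rwa [hs.graph_eq]) hr)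
    · have hc := hs.collider_of_notMem ⟨hne, by simp⟩ (by rwa [hs.graph_eq])
        (by
          rw [hs.graph_eq]
          exact Or.inl (hedge _ _ hab)) hbc.1 hr
      exact hbc.2.2 (hinit _ _ (hs.initArrow_of_collider hG hne.symm (fun h' => hn h'.symm)
        hc.2 hc.1))
  · obtain ⟨p, q, rfl, rfl⟩ := hs.present_of_unoriented hG hinit hun
    exact hclosed _ _ (.directed_path p q hab hun)
  · obtain ⟨p, q, rfl, rfl⟩ := hs.present_of_unoriented hG hinit hab
    obtain ⟨_, k, _, rfl⟩ := hs.present_of_unoriented hG hinit har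
    obtain ⟨_, k', _, rfl⟩ := hs.present_of_unoriented hG hinit har'
    by_contra hn
    exact hclosed _ _ (.two_paths p q k k' hab har hrb har' hrb' (fun e => hne (congrArg _ e))
      (by rwa [hs.graph_eq]))

/-- The remaining possibility `c → a → b` is a directed path along the unoriented edge `c - b`. -/
theorem IsClosedUnderRules.arrow_or_unoriented (hD : IsClosedUnderRules G s D)
    (hs : IsSkeletonOf G s) {a b c : Node ι} (hab : D a b) (hbc : Unoriented s D b c) :
    D a c ∨ Unoriented s D a c := by
  by_cases h1 : D a c
  · exact Or.inl h1
  · by_cases h2 : D c a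
    · exact (hD.not_path c b ((Relation.TransGen.single h2).tail hab) hbc.symm).elim
    · refine Or.inr ⟨?_, h1, h2⟩
      rw [hs.graph_eq]
      exact hD.adj a b c hab hbc

/-- An arrow into an endpoint of an unoriented edge comes with an arrow from the same vertex into
the other endpoint. -/
theorem IsClosedUnderRules.arrow_of_arrow_of_unoriented (hD : IsClosedUnderRules G s D)
    (hs : IsSkeletonOf G s) (hG : IsExtendedSummary G) {D₀ : Node ι → Node ι → Prop}
    (h : Relation.ReflTransGen (OrientStep s) (InitArrow s) D₀) (hle : ∀ a b, D₀ a b → D a b)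
    {a b c : Node ι} (hab : D₀ a b) (hbc : Unoriented s D b c) : D a c := by
  -- Induction on the stage `D₀` at which the arrow appears, with `D` fixed as the closed set. In
  -- each case `a - c` unoriented is refuted.
  induction h generalizing a b c with
  | refl =>
    refine (hD.arrow_or_unoriented hs (hle _ _ hab) hbc).resolve_right fun hac => ?_
    rcases hs.initArrow_cases hab with ⟨p, rfl⟩ | ⟨d, hne, hn, hGab, hGdb⟩
    · obtain ⟨_, _, h, _⟩ := hs.present_of_unoriented hG hD.init_le hac
      simp at h
    · have hdb := hD.init_le _ _ (hs.initArrow_of_collider hG hne.symm (fun h => hn h.symm)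
        hGdb hGab)
      rcases hD.arrow_or_unoriented hs hdb hbc with hdc | hdc
      · exact hn (hD.adj d c a hdc hac.symm).symm
      · exact hn (hD.not_two_paths c b a d hbc.symm hac.symm (hle _ _ hab) hdc.symm hdb hne)
  | @tail D₁ D₂ hrun hstep ih =>
    obtain ⟨u, v, hrule, rfl⟩ := hstep
    have hle' : ∀ a b, D₁ a b → D a b := fun a b h => hle a b (Or.inl h)
    rcases hab with hab | ⟨rfl, rfl⟩
    · exact ih hle' hab hbc
    · refine (hD.arrow_or_unoriented hs (hle _ _ (Or.inr ⟨rfl, rfl⟩)) hbc).resolve_right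
        fun hac => ?_
      rcases hrule with ⟨d, r, q, hdr, hrq, hne, hn, hr⟩ | ⟨p, q, hpath, hpq⟩ |
        ⟨p, q, r, r', hpq, hpr, hrq, hpr', hrq', hne, hn⟩
      · rw [hs.graph_eq] at hn
        exact hn (hD.adj d c _ (ih hle' hdr hac) hbc.symm)
      -- The last arrow of the path can be redirected to `c`, giving a directed path along the
      -- unoriented edge `a - c`.
      · obtain ⟨x, hx, hxq⟩ := Relation.TransGen.tail'_iff.1 hpath
        exact hD.not_path _ _ (Relation.TransGen.tail' (Relation.ReflTransGen.mono hle' _ _ hx)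
          (ih hle' hxq hbc)) hac
      · have hne' : (present r : Node ι) ≠ present r' := fun e => hne (Sum.inr_injective e)
        rw [hs.graph_eq] at hn
        -- An arrow `p → k` would combine with `k → c` into a directed path along the unoriented
        -- edge `p - c`.
        have cases : ∀ k, Unoriented s D₁ (present p) (present k) → D (present k) c →
            D (present k) (present p) ∨ Unoriented s D (present p) (present k) := by
          intro k hpk hkc
          by_cases h1 : D (present k) (present p)
          · exact Or.inl h1
          · refine Or.inr ⟨hpk.1, fun h2 => ?_, h1⟩
            exact hD.not_path _ _ ((Relation.TransGen.single h2).tail hkc) hac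
        have hrc := ih hle' hrq hbc
        have hrc' := ih hle' hrq' hbc
        rcases cases r hpr hrc with h1 | h1 <;> rcases cases r' hpr' hrc' with h2 | h2
        · exact hpr.2.2 (initArrow_le hrun (hs.initArrow_of_collider hG hne' hn
            (hD.edge _ _ h1) (hD.edge _ _ h2)))
        · exact hn (hD.adj _ _ _ h1 h2)
        · exact hn (hD.adj _ _ _ h2 h1).symm
        · exact hn (hD.not_two_paths _ c _ _ hac h1 hrc h2 hrc' hne')

/-- Every vertex is a source of the unoriented part in some extended summary graph with the same
pattern. -/
theorem IsSkeletonOf.exists_root [Finite ι] (hs : IsSkeletonOf G s) (hG : IsExtendedSummary G)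
    (h : Relation.ReflTransGen (OrientStep s) (InitArrow s) D)
    (hclosed : ∀ u v, ¬ OrientRule s D u v) (v : Node ι) :
    ∃ H : DAG (Node ι), IsExtendedSummary H ∧ DAG.SamePattern G H ∧
      ∀ w, Unoriented s D v w → H.edge v w := by
  classical
  let := Fintype.ofFinite (Node ι)
  have hD := hs.isClosedUnderRules hG h hclosed
  have key : ∀ {a b c}, D a b → Unoriented s D b c → D a c := fun hab hbc =>
    hD.arrow_of_arrow_of_unoriented hs hG h (fun _ _ => id) hab hbc
  let U : SimpleGraph (Node ι) :=
    { Adj := Unoriented s D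
      symm := ⟨fun _ _ => Unoriented.symm⟩
      loopless := ⟨fun u hu => s.graph.irrefl hu.1⟩ }
  obtain ⟨f, hf, hfG⟩ := G.exists_topological
  have hshield : ∀ x y z, x ≠ y → G.edge x z → G.edge y z → Unoriented s D x z →
      Unoriented s D y z → Unoriented s D x y := by
    intro x y z hxy hxz hyz hUx hUy
    have hadj : G.skeleton.Adj x y := by
      by_contra hn
      exact hUx.2.1 (hD.init_le _ _ (hs.initArrow_of_collider hG hxy hn hxz hyz))
    exact ⟨by rwa [hs.graph_eq], fun h' => hUx.2.1 (key h' hUy), fun h' => hUy.2.1 (key h' hUx)⟩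
  have hedge : ∀ {x z}, Unoriented s D x z → f x < f z → G.edge x z := by
    intro x z hxz hlt
    have hadj := hxz.1
    rw [hs.graph_eq] at hadj
    rcases hadj with h' | h'
    · exact h'
    · exact (hlt.not_gt (hfG _ _ h')).elim
  -- A topological order of `G` is perfect for the unoriented part: nonadjacent parents would form a
  -- collider with initial arrows, and an arrow between the parents would, by `key`, orient one of
  -- the two edges.
  have hperf : IsPerfectOn U Finset.univ f := fun x _ y _ z _ hxz hyz hUx hUy hxy =>
    hshield x y z hxy (hedge hUx hxz) (hedge hUy hyz) hUx hUy
  obtain ⟨g, hg, hgperf, hgmin⟩ := hperf.exists_root hf v Finset.univ (Finset.mem_univ v)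
  have hginj : ∀ {x y}, x ≠ y → g x < g y ∨ g y < g x := fun hxy =>
    lt_or_gt_of_ne fun e => hxy (hg (Finset.mem_coe.2 (Finset.mem_univ _))
      (Finset.mem_coe.2 (Finset.mem_univ _)) e)
  let E : Node ι → Node ι → Prop := fun x y => D x y ∨ (Unoriented s D x y ∧ g x < g y)
  let EU : Node ι → Node ι → Prop := fun x y => Unoriented s D x y ∧ g x < g y
  have hDacyclic : ∀ x, ¬ Relation.TransGen D x x := fun x hx =>
    G.acyclic x (Relation.TransGen.mono hD.edge _ _ hx)
  have hshift : ∀ {z x y}, Relation.TransGen D z x → Unoriented s D x y →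
      Relation.TransGen D z y := by
    intro z x y hzx hxy
    obtain ⟨w, hw, hwx⟩ := Relation.TransGen.tail'_iff.1 hzx
    exact Relation.TransGen.tail' hw (key hwx hxy)
  -- An arrow absorbs the unoriented edges that follow it, so newly oriented steps can be confined
  -- to the start. A cycle would then increase `g` or yield a cycle of `D`.
  have hdecomp : ∀ {x y}, Relation.TransGen E x y →
      Relation.TransGen EU x y ∨ ∃ z, Relation.ReflTransGen EU x z ∧ Relation.TransGen D z y := by
    intro x y hxy
    induction hxy with
    | single hxy =>
      rcases hxy with hxy | hxy
      · exact Or.inr ⟨x, .refl, .single hxy⟩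
      · exact Or.inl (.single hxy)
    | tail _ hyz ih =>
      rcases ih with ih | ⟨z, hz, hz'⟩ <;> rcases hyz with hyz | hyz
      · exact Or.inr ⟨_, ih.to_reflTransGen, .single hyz⟩
      · exact Or.inl (ih.tail hyz)
      · exact Or.inr ⟨z, hz, hz'.tail hyz⟩
      · exact Or.inr ⟨z, hz, hshift hz' hyz.1⟩
  have hlt : ∀ {x y}, Relation.TransGen EU x y → g x < g y := by
    intro x y hxy
    induction hxy with
    | single hxy => exact hxy.2
    | tail _ hyz ih => exact ih.trans hyz.2
  have hfollow : ∀ {z x y}, Relation.ReflTransGen EU x y → Relation.TransGen D z x →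
      Relation.TransGen D z y := by
    intro z x y hxy hzx
    induction hxy with
    | refl => exact hzx
    | tail _ hyz ih => exact hshift ih hyz.1
  let H : DAG (Node ι) :=
    { edge := E
      acyclic := fun x hx => by
        rcases hdecomp hx with hx | ⟨z, hz, hz'⟩
        · exact (hlt hx).ne rfl
        · exact hDacyclic z (hfollow hz hz') }
  have hadjH : ∀ a b, G.skeleton.Adj a b ↔ H.skeleton.Adj a b := by
    intro a b
    constructor
    · intro hab
      by_cases h1 : D a b
      · exact Or.inl (Or.inl h1)
      by_cases h2 : D b a
      · exact Or.inr (Or.inl h2)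
      have hun : Unoriented s D a b := ⟨by rwa [hs.graph_eq], h1, h2⟩
      rcases hginj hab.ne with h3 | h3
      · exact Or.inl (Or.inr ⟨hun, h3⟩)
      · exact Or.inr (Or.inr ⟨hun.symm, h3⟩)
    · have hE : ∀ {a b}, E a b → G.skeleton.Adj a b := by
        rintro a b (h1 | h1)
        · exact Or.inl (hD.edge _ _ h1)
        · rw [← hs.graph_eq]
          exact h1.1.1
      rintro (h1 | h1)
      · exact hE h1
      · exact (hE h1).symm
  refine ⟨H, fun u p hup => ?_, ⟨hadjH, fun a b c hac hn => ⟨fun h' => ?_, fun h' => ?_⟩⟩,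
    fun w hw => Or.inr ⟨hw, hgmin w (Finset.mem_univ w) hw.1.ne'⟩⟩
  · rcases hup with hup | hup
    · exact hG _ _ (hD.edge _ _ hup)
    · obtain ⟨_, _, _, h'⟩ := hs.present_of_unoriented hG hD.init_le hup.1
      simp at h'
  · exact ⟨Or.inl (hD.init_le _ _ (hs.initArrow_of_collider hG hac hn h'.1 h'.2)),
      Or.inl (hD.init_le _ _ (hs.initArrow_of_collider hG hac.symm (fun h => hn h.symm)
        h'.2 h'.1))⟩
  -- No new unshielded collider arises: an arrow meeting a newly oriented edge is shielded by `key`,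
  -- two newly oriented edges by perfectness of `g`.
  · rcases h' with ⟨h1 | h1, h2 | h2⟩
    · exact ⟨hD.edge _ _ h1, hD.edge _ _ h2⟩
    · exact (hn (Or.inl (hD.edge _ _ (key h1 h2.1.symm)))).elim
    · exact (hn (Or.inr (hD.edge _ _ (key h2 h1.1.symm)))).elim
    · have := hgperf a (Finset.mem_univ a) c (Finset.mem_univ c) b (Finset.mem_univ b) h1.2 h2.2
        h1.1 h2.1 hac
      exact (hn (hs.graph_eq ▸ this.1)).elim

theorem IsSkeletonOf.eq_cpdag [Finite ι] (hs : IsSkeletonOf G s) (hG : IsExtendedSummary G)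
    (h : Relation.ReflTransGen (OrientStep s) (InitArrow s) D)
    (hclosed : ∀ u v, ¬ OrientRule s D u v) : (⟨D, Unoriented s D⟩ : PDAG (Node ι)) = cpdag G := by
  have sound : ∀ {H : DAG (Node ι)}, IsExtendedSummary H → G.MarkovEquiv H →
      ∀ {u v}, D u v → H.edge u v := fun hH hGH _ _ huv =>
    hs.arrow_edge hG hGH.samePattern hH h huv
  have hself : G.MarkovEquiv G := fun _ _ _ _ _ _ => Iff.rfl
  have complete : ∀ {u v}, Unoriented s D u v →
      ∃ H : DAG (Node ι), IsExtendedSummary H ∧ G.MarkovEquiv H ∧ H.edge u v := by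
    intro u v huv
    obtain ⟨H, hH, hGH, hedge⟩ := hs.exists_root hG h hclosed u
    exact ⟨H, hH, hGH.markovEquiv, hedge v huv⟩
  ext u v
  · refine ⟨fun huv H hH hGH => sound hH hGH huv, fun hall => ?_⟩
    have huv := hall G hG hself
    by_contra hD
    by_cases hD' : D v u
    · exact DAG.not_edge_symm huv (sound hG hself hD')
    · have hun : Unoriented s D v u := ⟨by rw [hs.graph_eq]; exact Or.inr huv, hD', hD⟩
      obtain ⟨H, hH, hGH, hvu⟩ := complete hun
      exact DAG.not_edge_symm hvu (hall H hH hGH)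
  · refine ⟨fun huv => ⟨complete huv, complete huv.symm⟩, ?_⟩
    rintro ⟨⟨H₁, hH₁, hGH₁, h₁⟩, ⟨H₂, hH₂, hGH₂, h₂⟩⟩
    refine ⟨?_, fun huv => DAG.not_edge_symm h₂ (sound hH₂ hGH₂ huv),
      fun hvu => DAG.not_edge_symm h₁ (sound hH₁ hGH₁ hvu)⟩
    rw [hs.graph_eq, hGH₁.samePattern.adj]
    exact Or.inl h₁

theorem OrientRule.not_arrow {u v : Node ι} (h : OrientRule s D u v) : ¬ D u v := by
  rcases h with ⟨_, _, _, _, h, _⟩ | ⟨_, _, _, h⟩ | ⟨_, _, _, _, h, _⟩ <;> exact h.2.1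

/-- The orientation phase terminates. -/
theorem exists_orientation [Finite ι] (s : SkelState ι) (D : Node ι → Node ι → Prop) :
    ∃ D', Relation.ReflTransGen (OrientStep s) D D' ∧ ∀ u v, ¬ OrientRule s D' u v := by
  induction hn : {e : Node ι × Node ι | ¬ D e.1 e.2}.ncard using Nat.strong_induction_on
    generalizing D with
  | _ n ih =>
    by_cases hclosed : ∃ u v, OrientRule s D u v
    · obtain ⟨u, v, huv⟩ := hclosed
      obtain ⟨D', hD', hclosed'⟩ := ih _ (by
        rw [← hn]
        refine Set.ncard_lt_ncard (t := {e : Node ι × Node ι | ¬ D e.1 e.2}) ⟨?_, fun hsub => ?_⟩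
          (Set.toFinite _)
        · exact fun e he h' => he (Or.inl h')
        · exact hsub (a := (u, v)) huv.not_arrow (Or.inr ⟨rfl, rfl⟩))
        (fun a b => D a b ∨ (a = u ∧ b = v)) rfl
      exact ⟨D', hD'.head ⟨u, v, huv, rfl⟩, hclosed'⟩
    · push Not at hclosed
      exact ⟨D, .refl, hclosed⟩

end Orientation

end PCGCE

theorem mainTheorem2 {ι Ω : Type*} [Fintype ι] [MeasurableSpace Ω]
    (μ : MeasureTheory.Measure Ω) [MeasureTheory.IsProbabilityMeasure μ]
    (X : ι → ℤ → Ω → ℝ) (hX : ∀ p s, Measurable (X p s)) (t : ℤ) (γ : ℕ)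
    (G : PCGCE.DAG (PCGCE.Node ι)) (hG : PCGCE.IsExtendedSummary G)
    (hfaithful : PCGCE.Faithful (PCGCE.jointLaw X t γ μ) G) :
    (∃ P, PCGCE.IsOutput X t γ μ P) ∧
      ∀ P, PCGCE.IsOutput X t γ μ P → P = PCGCE.cpdag G := by
  have htest : PCGCE.TestsDecide X t γ μ G := fun _ _ _ huv hu hv =>
    hfaithful.testedIndep_iff hX huv hu hv
  constructor
  · obtain ⟨s, hs⟩ := PCGCE.exists_skelRun X t γ μ (Fintype.card (PCGCE.Node ι))
    obtain ⟨D, hD, hclosed⟩ := PCGCE.exists_orientation s (PCGCE.InitArrow s)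
    exact ⟨_, s, D, hs, hD, hclosed, rfl⟩
  · rintro P ⟨s, D, hs, hD, hclosed, rfl⟩
    have hgraph := hs.graph_eq hG htest
    refine PCGCE.IsSkeletonOf.eq_cpdag ⟨hgraph, fun u v huv hn => ?_⟩ hG hD hclosed
    exact (hs.inv hG htest).sep u v huv (by rwa [hgraph])
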